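/- Let $(\mathcal G,T)$ be a finite tree of groups: $T$ is a finite tree, with a group $G_v$ for each vertex $v$, a group $G_e$ for each (unoriented) edge $e$, and a monomorphism $\iota_{e,v}\colon G_e\to G_v$ for each edge $e$ and each endpoint $v$ of $e$. Assume that every $G_v$ is free abelian of finite rank and that every $G_e$ is cyclic, and let $k_e$ be a generator of $G_e$. Call a vertex of $T$ external if it is a leaf, that is, if it has exactly one neighbour, and internal otherwise. Define the diameter of $T$ as the number of vertices in a longest path between external vertices, and assume that it equals $4$; then exactly one edge of $T$, called the bridge, joins two internal vertices. Call an element of a free abelian group of finite rank primitive if it belongs to some free generating set (basis) of the group. Suppose that (a) if $e$ is the bridge and $v$ is either of its endpoints, then $\iota_{e,v}(k_e)$ is primitive in $G_v$; (b) if $e$ is an edge incident to an external vertex $v$, then $\iota_{e,v}(k_e)$ is primitive in $G_v$. (Nothing beyond injectivity is assumed of $\iota_{e,u}$ when $e$ joins an external vertex to an internal vertex $u$.) Then the fundamental group $G=\pi_1(\mathcal G,T)$ is $\mathbb Z$-linear, i.e. there are $n\in\mathbb N$ and an injective homomorphism $G\to GL_n(\mathbb Z)$. Here $\pi_1(\mathcal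 G,T)$ is the quotient of the free product of all vertex groups and of the free group on letters $t_d$, one for each oriented edge $d$ of $T$, by the relations $t_d\,\alpha_d(g)\,t_d^{-1}=\omega_d(g)$ and $t_dt_{\bar d}=1$ for all oriented edges $d$ and all $g$ in the group of $d$, and $t_d=1$ for all oriented edges $d$ of $T$. The homomorphisms $\alpha_d$ and $\omega_d$ are the monomorphisms of the edge group of $d$ into the groups of the initial and the terminal vertex of $d$, and $\bar d$ is the reverse of $d$. -/

import Mathlib

universe u v w

/-- A graph of groups over a simple graph `Γ`: a group `G_v` for each vertex, a group `G_e` for each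
(unoriented) edge, and for each edge `e` and each endpoint `v` of `e` a monomorphism `G_e → G_v`.
As edge groups are indexed by unoriented edges, the two orientations of an edge share one edge
group. -/
structure GraphOfGroups {V : Type u} (Γ : SimpleGraph V) where
  vertexGroup : V → Type v
  [vertexGroupInst : ∀ x, Group (vertexGroup x)]
  edgeGroup : Γ.edgeSet → Type w
  [edgeGroupInst : ∀ e, Group (edgeGroup e)]
  incl : ∀ (e : Γ.edgeSet) (x : V), x ∈ (e : Sym2 V) → edgeGroup e →* vertexGroup x
  incl_injective : ∀ (e : Γ.edgeSet) (x : V) (hx : x ∈ (e : Sym2 V)),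
    Function.Injective (incl e x hx)

namespace GraphOfGroups

attribute [instance] GraphOfGroups.vertexGroupInst GraphOfGroups.edgeGroupInst

variable {V : Type u} {Γ : SimpleGraph V} (G : GraphOfGroups.{u, v, w} Γ)

/-- The unoriented edge underlying an oriented edge. -/
def edgeOf (d : Γ.Dart) : Γ.edgeSet := ⟨d.edge, d.edge_mem⟩

/-- The monomorphism `α_d` of the edge group into the group of the initial vertex of the oriented
edge `d`. -/
def initialMap (d : Γ.Dart) : G.edgeGroup (edgeOf d) →* G.vertexGroup d.fst :=
  G.incl (edgeOf d) d.fst (Sym2.mem_mk_left d.fst d.snd)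

/-- The monomorphism `ω_d` of the edge group into the group of the terminal vertex of the oriented
edge `d`. -/
def terminalMap (d : Γ.Dart) : G.edgeGroup (edgeOf d) →* G.vertexGroup d.snd :=
  G.incl (edgeOf d) d.snd (Sym2.mem_mk_right d.fst d.snd)

/-- The free product of all vertex groups and of the free group on the oriented edges. -/
abbrev BigFreeProduct : Type (max u v) :=
  Monoid.Coprod (Monoid.CoprodI G.vertexGroup) (FreeGroup Γ.Dart)

/-- A vertex group element in the free product. -/
def vertexElt {x : V} (g : G.vertexGroup x) : G.BigFreeProduct :=
  Monoid.Coprod.inl (Monoid.CoprodI.of g)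

/-- The stable letter `t_d` in the free product. -/
def stableLetter (d : Γ.Dart) : G.BigFreeProduct :=
  Monoid.Coprod.inr (FreeGroup.of d)

/-- The relators `t_d α_d(g) t_d⁻¹ ω_d(g)⁻¹` and `t_d t_{d⁻¹}` of the path group. -/
def pathRelators : Set G.BigFreeProduct :=
  {r | ∃ (d : Γ.Dart) (g : G.edgeGroup (edgeOf d)),
      r = G.stableLetter d * G.vertexElt (G.initialMap d g) * (G.stableLetter d)⁻¹ *
        (G.vertexElt (G.terminalMap d g))⁻¹} ∪
  {r | ∃ d : Γ.Dart, r = G.stableLetter d * G.stableLetter d.symm}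

/-- The path group of the graph of groups. -/
abbrev PathGroup : Type (max u v) :=
  G.BigFreeProduct ⧸ Subgroup.normalClosure G.pathRelators

/-- The stable letters of the oriented edges of a subgraph `T`, in the path group. -/
def treeLetters (T : SimpleGraph V) : Set G.PathGroup :=
  {r | ∃ d : Γ.Dart, T.Adj d.fst d.snd ∧
    r = QuotientGroup.mk' (Subgroup.normalClosure G.pathRelators) (G.stableLetter d)}

/-- The fundamental group of the graph of groups over `Γ` with respect to a maximal subtree `T` of
`Γ`: the path group modulo the normal closure of the letters `t_d` for the edges `d` of `T`. -/
abbrev FundamentalGroup (T : SimpleGraph V) : Type (max u v) :=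
  G.PathGroup ⧸ Subgroup.normalClosure (G.treeLetters T)

end GraphOfGroups

/-- `b` is a free generating family of the (multiplicative) free abelian group `A`: some isomorphism
of `A` with `ℤ^(ι)` takes `b` to the standard basis. -/
def IsFreeAbelianBasis {A : Type*} [Group A] {ι : Type*} (b : ι → A) : Prop :=
  ∃ f : A ≃* Multiplicative (ι →₀ ℤ), ∀ i, f (b i) = Multiplicative.ofAdd (Finsupp.single i 1)

/-- `A` is a free abelian group of finite rank. -/
def IsFreeAbelianOfFiniteRank (A : Type*) [Group A] : Prop :=
  ∃ (n : ℕ) (b : Fin n → A), IsFreeAbelianBasis b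

/-- `a` is a primitive element of the free abelian group `A`: it belongs to a finite free generating
set of `A`. -/
def IsPrimitiveElt {A : Type*} [Group A] (a : A) : Prop :=
  ∃ (n : ℕ) (b : Fin n → A), IsFreeAbelianBasis b ∧ ∃ i, b i = a

/-- A group is `ℤ`-linear if it embeds into `GL_n(ℤ)` for some `n`. -/
def IsZLinear (H : Type*) [Group H] : Prop :=
  ∃ (n : ℕ) (ρ : H →* Matrix.GeneralLinearGroup (Fin n) ℤ), Function.Injective ρ

/-- An external vertex (leaf): a vertex with exactly one neighbour. -/
def IsExternalVertex {V : Type*} (T : SimpleGraph V) (x : V) : Prop :=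
  ∃! y, T.Adj x y

/-- The diameter of the tree `T`, counted as the number of vertices in a longest path between
external vertices, is `n`. -/
def HasTreeDiameter {V : Type*} (T : SimpleGraph V) (n : ℕ) : Prop :=
  IsGreatest {m : ℕ | ∃ (x y : V) (p : T.Walk x y), IsExternalVertex T x ∧ IsExternalVertex T y ∧
    p.IsPath ∧ p.support.length = m} n

/-- The bridge of a tree of diameter `4`: an edge both of whose endpoints are internal vertices. -/
def IsInternalEdge {V : Type*} {T : SimpleGraph V} (e : T.edgeSet) : Prop :=
  ∀ x ∈ (e : Sym2 V), ¬ IsExternalVertex T x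

/-! Let `R` be the amalgam of the two bridge vertex groups along the bridge group. By (b), the group
of the `i`-th leaf splits as `⟨k_e⟩ × L i`, so `G` is the amalgam of `R` with the groups `⟨x i⟩ × L
i` along `⟨x i⟩`, where `x i ≠ 1` is the image of `k_e` in a bridge vertex group. Killing all `L i`
retracts `G` onto `R`. Hence `G` is `ℤ`-linear once `R` is and some integral representation of `G`
has its kernel inside `R` (`FormRep.isZLinear`).

Such a representation comes from a lattice on which `R` acts by isometries, with isotropic vectors
`δ i` whose stabilizers are the groups `⟨x i⟩`. Each `L i` acts by Eichler transformations along `δ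
i`. These commute with `x i`, so the actions glue to `G`. Distinct translates of the `δ i` pair to
at most `-12`, and a ping-pong argument (`IsCommutingExtension.form_lt`) gives `(g e, e) < (e, e)`
for an `R`-fixed vector `e` and all `g` outside `R`.

The vectors `δ i` exist if each `⟨x i⟩` is detected in `R` by the same kind of inequality
(`FormRep`). The method therefore iterates: it consumes detections of cyclic subgroups and produces
a detection of the base group (`IsCommutingExtension.nonempty_formRep_range`). By (a), `R` is itself
such an extension of either bridge vertex group. This yields the linearity of `R` and, together with
a retraction of `R` onto a factor, the detection of `⟨x i⟩`
(`CyclicAmalgam.nonempty_formRep_zpowers_of`). The iteration starts from cyclic subgroups of `ℤ^n`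
(`nonempty_formRep_zpowers`). -/

/-! ### Eichler transformations -/

section Eichler

variable {M : Type*} [AddCommGroup M] {J : Type*} [Fintype J]

/-- `δ` is isotropic and orthogonal to the family `f`, whose members are pairwise orthogonal of
square `2`. -/
structure IsEichlerPair (B : LinearMap.BilinForm ℤ M) (f : J → M) (δ : M) : Prop where
  symm : ∀ x y, B x y = B y x
  isotropic : B δ δ = 0
  orthogonal : ∀ j, B δ (f j) = 0
  square : ∀ j, B (f j) (f j) = 2
  pairwise : ∀ i j, i ≠ j → B (f i) (f j) = 0

/-- The Eichler transformation of the isotropic vector `δ` and of the vector `∑ j, l j • f j`. -/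
def eichlerMap (B : LinearMap.BilinForm ℤ M) (f : J → M) (δ : M) (l : J → ℤ) : M →ₗ[ℤ] M where
  -- The usual coefficient `(v, v) / 2` for `v = ∑ l j • f j` is `∑ l j ^ 2`, because the `f j` are
  -- orthogonal of square `2`; so the map is integral.
  toFun x := x + B x δ • ∑ j, l j • f j - (∑ j, l j * B x (f j) + (∑ j, l j ^ 2) * B x δ) • δ
  map_add' x y := by
    simp only [map_add, LinearMap.add_apply, mul_add, Finset.sum_add_distrib]
    module
  map_smul' c x := by
    have h : ∑ j, l j * (c * B x (f j)) = c * ∑ j, l j * B x (f j) := by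
      rw [Finset.mul_sum]
      exact Finset.sum_congr rfl fun j _ => by ring
    simp only [map_smul, LinearMap.smul_apply, smul_eq_mul, RingHom.id_apply, h]
    module

variable {B : LinearMap.BilinForm ℤ M} {f : J → M} {δ : M}

theorem eichlerMap_apply (l : J → ℤ) (x : M) :
    eichlerMap B f δ l x =
      x + B x δ • ∑ j, l j • f j - (∑ j, l j * B x (f j) + (∑ j, l j ^ 2) * B x δ) • δ :=
  rfl

namespace IsEichlerPair

theorem form_sum_left (h : IsEichlerPair B f δ) (l : J → ℤ) (i : J) :
    B (∑ j, l j • f j) (f i) = 2 * l i := by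
  classical
  simp only [map_sum, LinearMap.sum_apply, map_smul, LinearMap.smul_apply, smul_eq_mul]
  rw [Finset.sum_eq_single i (fun j _ hj => by rw [h.pairwise j i hj, mul_zero]) (by simp),
    h.square, mul_comm]

theorem form_sum_isotropic (h : IsEichlerPair B f δ) (l : J → ℤ) :
    B (∑ j, l j • f j) δ = 0 := by
  simp [map_sum, LinearMap.sum_apply, h.symm _ δ, h.orthogonal]

theorem form_eichlerMap_vec (h : IsEichlerPair B f δ) (l : J → ℤ) (x : M) (i : J) :
    B (eichlerMap B f δ l x) (f i) = B x (f i) + 2 * l i * B x δ := by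
  simp only [eichlerMap_apply, map_add, map_sub, map_smul, LinearMap.add_apply,
    LinearMap.sub_apply, LinearMap.smul_apply, smul_eq_mul, h.form_sum_left, h.orthogonal]
  ring

theorem form_eichlerMap_isotropic (h : IsEichlerPair B f δ) (l : J → ℤ) (x : M) :
    B (eichlerMap B f δ l x) δ = B x δ := by
  simp only [eichlerMap_apply, map_add, map_sub, map_smul, LinearMap.add_apply,
    LinearMap.sub_apply, LinearMap.smul_apply, smul_eq_mul, h.form_sum_isotropic, h.isotropic]
  ring

/-- The pairing of a transformed vector with a vector orthogonal to the family `f`. -/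
theorem form_eichlerMap_of_orthogonal (l : J → ℤ) (x y : M) (hy : ∀ j, B (f j) y = 0) :
    B (eichlerMap B f δ l x) y =
      B x y - (∑ j, l j * B x (f j) + (∑ j, l j ^ 2) * B x δ) * B δ y := by
  have h0 : B (∑ j, l j • f j) y = 0 := by simp [map_sum, LinearMap.sum_apply, hy]
  simp only [eichlerMap_apply, map_add, map_sub, map_smul, LinearMap.add_apply,
    LinearMap.sub_apply, LinearMap.smul_apply, smul_eq_mul, h0]
  ring

theorem eichlerMap_zero : eichlerMap B f δ 0 = 1 := by
  ext x
  simp [eichlerMap_apply]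

/-- The inner map shifts the pairing with `f j` by `2 * l' j * B x δ`, which supplies the cross term
of `∑ (l j + l' j) ^ 2`. -/
theorem eichlerMap_add (h : IsEichlerPair B f δ) (l l' : J → ℤ) :
    eichlerMap B f δ (l + l') = eichlerMap B f δ l * eichlerMap B f δ l' := by
  ext x
  rw [Module.End.mul_apply, eichlerMap_apply l, h.form_eichlerMap_isotropic]
  simp only [h.form_eichlerMap_vec]
  simp only [eichlerMap_apply, Pi.add_apply]
  have h1 : ∑ j, (l j + l' j) • f j = ∑ j, l j • f j + ∑ j, l' j • f j := by
    simp [add_smul, Finset.sum_add_distrib]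
  have h2 : ∑ j, (l j + l' j) * B x (f j) = ∑ j, l j * B x (f j) + ∑ j, l' j * B x (f j) := by
    simp [add_mul, Finset.sum_add_distrib]
  have h3 : ∑ j, (l j + l' j) ^ 2 = ∑ j, l j ^ 2 + 2 * ∑ j, l j * l' j + ∑ j, l' j ^ 2 := by
    rw [Finset.mul_sum, ← Finset.sum_add_distrib, ← Finset.sum_add_distrib]
    exact Finset.sum_congr rfl fun j _ => by ring
  have h4 : ∑ j, l j * (B x (f j) + 2 * l' j * B x δ) =
      ∑ j, l j * B x (f j) + 2 * (∑ j, l j * l' j) * B x δ := by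
    rw [Finset.mul_sum, Finset.sum_mul, ← Finset.sum_add_distrib]
    exact Finset.sum_congr rfl fun j _ => by ring
  rw [h1, h2, h3, h4]
  module

/-- The Eichler transformations of an isotropic vector as a representation of `ℤ^J`. -/
noncomputable def rep (h : IsEichlerPair B f δ) : Multiplicative (J → ℤ) →* (M ≃ₗ[ℤ] M) :=
  (LinearMap.GeneralLinearGroup.generalLinearEquiv ℤ M).toMonoidHom.comp
    (MonoidHom.toHomUnits
      { toFun := fun l => eichlerMap B f δ l.toAdd
        map_one' := eichlerMap_zero
        map_mul' := fun l l' => h.eichlerMap_add l.toAdd l'.toAdd })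

theorem rep_apply (h : IsEichlerPair B f δ) (l : Multiplicative (J → ℤ)) (x : M) :
    h.rep l x = eichlerMap B f δ l.toAdd x :=
  rfl

theorem form_rep (h : IsEichlerPair B f δ) (l : Multiplicative (J → ℤ)) (x y : M) :
    B (h.rep l x) (h.rep l y) = B x y := by
  have hs : ∀ z, B z (∑ j, l.toAdd j • f j) = ∑ j, l.toAdd j * B z (f j) := fun z => by
    simp [map_sum]
  rw [h.rep_apply l y, eichlerMap_apply]
  simp only [map_add, map_sub, map_smul, smul_eq_mul, hs, h.rep_apply,
    h.form_eichlerMap_isotropic, h.form_eichlerMap_vec]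
  have h1 : B (eichlerMap B f δ l.toAdd x) y = B x y + B x δ * ∑ j, l.toAdd j * B y (f j) -
      (∑ j, l.toAdd j * B x (f j) + (∑ j, l.toAdd j ^ 2) * B x δ) * B y δ := by
    rw [eichlerMap_apply, h.symm _ y]
    simp only [map_add, map_sub, map_smul, smul_eq_mul, hs]
    rw [h.symm y x]
  have h2 : ∑ j, l.toAdd j * (B x (f j) + 2 * l.toAdd j * B x δ) =
      ∑ j, l.toAdd j * B x (f j) + 2 * (∑ j, l.toAdd j ^ 2) * B x δ := by
    rw [Finset.mul_sum, Finset.sum_mul, ← Finset.sum_add_distrib]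
    exact Finset.sum_congr rfl fun j _ => by ring
  rw [h1, h2]
  ring

/-- An isometry that fixes the family `f` conjugates Eichler transformations to Eichler
transformations. -/
theorem apply_eichlerMap (u : M ≃ₗ[ℤ] M) (hu : ∀ x y, B (u x) (u y) = B x y)
    (hf : ∀ j, u (f j) = f j) (l : J → ℤ) (x : M) :
    u (eichlerMap B f δ l x) = eichlerMap B f (u δ) l (u x) := by
  have h1 : ∀ j, B (u x) (f j) = B x (f j) := fun j => by
    conv_lhs => rw [← hf j, hu]
  simp only [eichlerMap_apply, map_add, map_sub, map_smul, map_sum, hf, hu, h1]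

theorem commute_rep (h : IsEichlerPair B f δ) (u : M ≃ₗ[ℤ] M)
    (hu : ∀ x y, B (u x) (u y) = B x y) (hf : ∀ j, u (f j) = f j) (hδ : u δ = δ)
    (l : Multiplicative (J → ℤ)) : Commute u (h.rep l) := by
  ext x
  simp only [LinearEquiv.mul_apply, h.rep_apply, apply_eichlerMap u hu hf, hδ]

end IsEichlerPair

/-- One step of the ping-pong: if the entries of `l` are not all zero and `x` pairs with the
isotropic vector `δ` more negatively than with the family `f`, then the transformed vector pairs
very negatively with each vector that pairs very negatively with `δ`. -/
theorem IsEichlerPair.growth (h : IsEichlerPair B f δ) {l : J → ℤ} (hl : l ≠ 0) {x y : M}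
    (hx : 0 < -B x δ) (hxf : ∀ j, 2 * |B x (f j)| ≤ -B x δ) (hy : ∀ j, B (f j) y = 0)
    (hδy : B δ y ≤ -12) :
    B (eichlerMap B f δ l x) y < B x y ∧
      ∀ j, 2 * |B (eichlerMap B f δ l x) (f j)| ≤ B x y - B (eichlerMap B f δ l x) y := by
  obtain ⟨j₀, hj₀⟩ := Function.ne_iff.mp hl
  have habs : ∀ j, |l j| ≤ l j ^ 2 := fun j => by
    rw [← sq_abs]
    exact Int.le_self_sq _
  have hsq : ∀ j, l j ^ 2 ≤ ∑ j, l j ^ 2 := fun j =>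
    Finset.single_le_sum (f := fun j => l j ^ 2) (fun j _ => sq_nonneg (l j)) (Finset.mem_univ j)
  have hS : 1 ≤ ∑ j, l j ^ 2 :=
    le_trans (le_trans (Int.one_le_abs hj₀) (habs j₀)) (hsq j₀)
  -- The linear term, whatever its sign, cancels at most half of the quadratic one; integrality of
  -- `l` enters through `|l j| ≤ l j ^ 2`.
  have hsum : 2 * ∑ j, l j * B x (f j) ≤ (∑ j, l j ^ 2) * -B x δ := by
    rw [Finset.mul_sum, Finset.sum_mul]
    refine Finset.sum_le_sum fun j _ => ?_
    calc 2 * (l j * B x (f j)) ≤ 2 * |l j * B x (f j)| := by gcongr; exact le_abs_self _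
      _ = |l j| * (2 * |B x (f j)|) := by rw [abs_mul]; ring
      _ ≤ l j ^ 2 * -B x δ := mul_le_mul (habs j) (hxf j) (by positivity) (sq_nonneg _)
  rw [form_eichlerMap_of_orthogonal l x y hy]
  generalize (∑ j, l j ^ 2) = S at *
  generalize (∑ j, l j * B x (f j)) = b at *
  set a := -B x δ with ha
  have hBa : B x δ = -a := by omega
  have hSa : a ≤ S * a := le_mul_of_one_le_left hx.le hS
  -- The first factor is at most `-(S * a) / 2` and the second at most `-12`.
  have key : 6 * (S * a) ≤ (b + S * B x δ) * B δ y := by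
    rw [hBa]
    nlinarith
  refine ⟨by linarith, fun j => ?_⟩
  rw [h.form_eichlerMap_vec]
  -- Doubled, this is at most `a + 4 * S * a ≤ 5 * S * a`, below the drop of `6 * S * a` in `key`.
  -- This is what the constant `-12` must ensure.
  have h1 : |B x (f j) + 2 * l j * B x δ| ≤ |B x (f j)| + 2 * (S * a) := by
    refine (abs_add_le _ _).trans (add_le_add_right ?_ _)
    rw [hBa, abs_mul, abs_mul, abs_neg, abs_of_pos hx, abs_two, mul_assoc]
    gcongr
    exact (habs j).trans (hsq j)
  have h2 := hxf j
  linarith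

end Eichler

/-! ### Subgroups detected by integral isometries -/

/-- A representation of `R` by isometries of a lattice with a symmetric form, and a vector `vec`
that is fixed by the subgroup `S` and satisfies `(g vec, vec) < (vec, vec)` for all other `g`. -/
structure FormRep (R : Type*) [Group R] (S : Subgroup R) where
  carrier : Type
  [addCommGroup : AddCommGroup carrier]
  [free : Module.Free ℤ carrier]
  [finite : Module.Finite ℤ carrier]
  form : LinearMap.BilinForm ℤ carrier
  symm : ∀ x y, form x y = form y x
  rep : R →* (carrier ≃ₗ[ℤ] carrier)
  form_rep : ∀ g x y, form (rep g x) (rep g y) = form x y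
  vec : carrier
  rep_vec : ∀ g ∈ S, rep g vec = vec
  -- The strict inequality is stronger than `rep g vec ≠ vec`: it adds up in orthogonal sums and
  -- drives the ping-pong.
  form_lt : ∀ g, g ∉ S → form (rep g vec) vec < form vec vec

attribute [instance] FormRep.addCommGroup FormRep.free FormRep.finite

namespace FormRep

variable {R R' : Type*} [Group R] [Group R'] {S S' : Subgroup R}

/-- Pullback along a homomorphism. -/
def comap (D : FormRep R S) (φ : R' →* R) : FormRep R' (S.comap φ) where
  carrier := D.carrier
  form := D.form
  symm := D.symm
  rep := D.rep.comp φ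
  form_rep g := D.form_rep (φ g)
  vec := D.vec
  rep_vec g hg := D.rep_vec (φ g) hg
  form_lt g hg := D.form_lt (φ g) hg

theorem form_le (D : FormRep R S) (g : R) : D.form (D.rep g D.vec) D.vec ≤ D.form D.vec D.vec := by
  by_cases hg : g ∈ S
  · rw [D.rep_vec g hg]
  · exact (D.form_lt g hg).le

/-- The product of two representations, which acts on pairs. -/
def prodRep {M N : Type*} [AddCommGroup M] [AddCommGroup N] (ρ : R →* (M ≃ₗ[ℤ] M))
    (τ : R →* (N ≃ₗ[ℤ] N)) : R →* ((M × N) ≃ₗ[ℤ] (M × N)) where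
  toFun g := (ρ g).prodCongr (τ g)
  map_one' := by ext <;> simp
  map_mul' g h := by ext <;> simp

@[simp]
theorem prodRep_apply {M N : Type*} [AddCommGroup M] [AddCommGroup N] (ρ : R →* (M ≃ₗ[ℤ] M))
    (τ : R →* (N ≃ₗ[ℤ] N)) (g : R) (x : M × N) : prodRep ρ τ g x = (ρ g x.1, τ g x.2) :=
  rfl

/-- The orthogonal sum of two representations detects the intersection. -/
def inf (D : FormRep R S) (D' : FormRep R S') : FormRep R (S ⊓ S') where
  carrier := D.carrier × D'.carrier
  form := D.form.compl₁₂ (LinearMap.fst ℤ _ _) (LinearMap.fst ℤ _ _) +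
    D'.form.compl₁₂ (LinearMap.snd ℤ _ _) (LinearMap.snd ℤ _ _)
  symm x y := by simp [D.symm x.1 y.1, D'.symm x.2 y.2]
  rep := prodRep D.rep D'.rep
  form_rep g x y := by simp [D.form_rep, D'.form_rep]
  vec := (D.vec, D'.vec)
  rep_vec g hg := by simp [D.rep_vec g hg.1, D'.rep_vec g hg.2]
  form_lt g hg := by
    have h1 := D.form_le g
    have h2 := D'.form_le g
    simp only [prodRep_apply, LinearMap.add_apply, LinearMap.compl₁₂_apply, LinearMap.fst_apply,
      LinearMap.snd_apply]
    by_cases hS : g ∈ S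
    · have := D'.form_lt g fun hS' => hg ⟨hS, hS'⟩
      linarith
    · have := D.form_lt g hS
      linarith

/-- Transport along an equality of subgroups. -/
def copy (D : FormRep R S) (h : S' = S) : FormRep R S' where
  carrier := D.carrier
  form := D.form
  symm := D.symm
  rep := D.rep
  form_rep := D.form_rep
  vec := D.vec
  rep_vec := by simpa only [h] using D.rep_vec
  form_lt := by simpa only [h] using D.form_lt

theorem mem_of_rep_eq_one (D : FormRep R S) {g : R} (hg : D.rep g = 1) : g ∈ S := by
  by_contra h
  simpa [hg] using D.form_lt g h

end FormRep

/-! ### Forms and detected subgroups of free abelian groups -/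

/-- The standard form on `ℤ^J` scaled by `2`. -/
def twiceStandardForm (J : Type*) [Fintype J] : LinearMap.BilinForm ℤ (J → ℤ) :=
  LinearMap.mk₂ ℤ (fun x y => 2 * (x ⬝ᵥ y)) (by simp [mul_add])
    (fun c x y => by rw [smul_dotProduct, smul_eq_mul, smul_eq_mul]; ring) (by simp [mul_add])
    (fun c x y => by rw [dotProduct_smul, smul_eq_mul, smul_eq_mul]; ring)

@[simp]
theorem twiceStandardForm_apply {J : Type*} [Fintype J] (x y : J → ℤ) :
    twiceStandardForm J x y = 2 * (x ⬝ᵥ y) :=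
  rfl

/-- The hyperbolic plane, whose basis vectors are isotropic and pair to `-1`. -/
def hyperbolicForm : LinearMap.BilinForm ℤ (ℤ × ℤ) :=
  LinearMap.mk₂ ℤ (fun x y => -(x.1 * y.2 + x.2 * y.1)) (by simp; grind) (by simp; grind)
    (by simp; grind) (by simp; grind)

@[simp]
theorem hyperbolicForm_apply (x y : ℤ × ℤ) : hyperbolicForm x y = -(x.1 * y.2 + x.2 * y.1) :=
  rfl

/-- The orthogonal sum of a form with the form `twiceStandardForm`. -/
def sumStandardForm {M : Type*} [AddCommGroup M] (B : LinearMap.BilinForm ℤ M) (J : Type*)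
    [Fintype J] : LinearMap.BilinForm ℤ (M × (J → ℤ)) :=
  B.compl₁₂ (LinearMap.fst ℤ _ _) (LinearMap.fst ℤ _ _) +
    (twiceStandardForm J).compl₁₂ (LinearMap.snd ℤ _ _) (LinearMap.snd ℤ _ _)

@[simp]
theorem sumStandardForm_apply {M : Type*} [AddCommGroup M] (B : LinearMap.BilinForm ℤ M)
    {J : Type*} [Fintype J] (x y : M × (J → ℤ)) :
    sumStandardForm B J x y = B x.1 y.1 + 2 * (x.2 ⬝ᵥ y.2) := by
  simp [sumStandardForm]

theorem isEichlerPair_sumStandardForm {M : Type*} [AddCommGroup M] {B : LinearMap.BilinForm ℤ M}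
    (hB : ∀ x y, B x y = B y x) (J : Type*) [Fintype J] [DecidableEq J] {δ : M} (hδ : B δ δ = 0) :
    IsEichlerPair (sumStandardForm B J) (fun j => (0, Pi.single j 1)) (δ, 0) where
  symm x y := by simp [hB x.1 y.1, dotProduct_comm x.2 y.2]
  isotropic := by simp [hδ]
  orthogonal j := by simp
  square j := by simp
  pairwise i j hij := by simp [hij]

/-- Kernels of homomorphisms to `ℤ^J` are detected by a group of parabolic isometries. -/
theorem nonempty_formRep_ker {R : Type*} [Group R] {J : Type} [Fintype J]
    (φ : R →* Multiplicative (J → ℤ)) : Nonempty (FormRep R φ.ker) := by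
  classical
  have h := isEichlerPair_sumStandardForm (B := hyperbolicForm) (by simp; grind) J
    (δ := (1, 0)) (by simp)
  refine ⟨{
    carrier := (ℤ × ℤ) × (J → ℤ)
    form := sumStandardForm hyperbolicForm J
    symm := h.symm
    rep := h.rep.comp φ
    form_rep := fun g => h.form_rep (φ g)
    vec := ((0, 1), 0)
    rep_vec := fun g hg => by simp [MonoidHom.mem_ker.mp hg]
    form_lt := fun g hg => ?_ }⟩
  have hl : (φ g).toAdd ≠ 0 := fun h0 => hg (MonoidHom.mem_ker.mpr h0)
  obtain ⟨j, hj⟩ := Function.ne_iff.mp hl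
  have hpos : 0 < ∑ j, (φ g).toAdd j ^ 2 :=
    Finset.sum_pos' (fun j _ => sq_nonneg _) ⟨j, Finset.mem_univ j, sq_pos_of_ne_zero hj⟩
  -- The chosen vector is orthogonal to the `f j` and pairs to `-1` with the isotropic vector, so
  -- its pairing drops from `0` to `-∑ l j ^ 2`.
  rw [MonoidHom.comp_apply, h.rep_apply, IsEichlerPair.form_eichlerMap_of_orthogonal _ _ _ (by simp)]
  simpa using hpos

/-- Subgroups of finite index are detected by the permutation representation on cosets. -/
theorem nonempty_formRep_of_finite_quotient {R : Type} [Group R] (S : Subgroup R) [Finite (R ⧸ S)] :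
    Nonempty (FormRep R S) := by
  classical
  have := Fintype.ofFinite (R ⧸ S)
  refine ⟨{
    carrier := (R ⧸ S) → ℤ
    form := twiceStandardForm (R ⧸ S)
    symm := fun x y => by simp [dotProduct_comm x y]
    rep :=
      { toFun := fun g => LinearEquiv.funCongrLeft ℤ ℤ (MulAction.toPerm g⁻¹)
        map_one' := by ext; simp
        map_mul' := fun g h => by ext; simp [mul_smul] }
    form_rep := fun g x y => ?_
    vec := Pi.single (QuotientGroup.mk 1) 1
    rep_vec := fun g hg => ?_
    form_lt := fun g hg => ?_ }⟩
  · simpa [dotProduct, LinearEquiv.funCongrLeft_apply, LinearMap.funLeft_apply] using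
      Equiv.sum_comp (MulAction.toPerm g⁻¹) fun i => x i * y i
  · ext q
    have : g⁻¹ • q = QuotientGroup.mk 1 ↔ q = QuotientGroup.mk 1 := by
      rw [inv_smul_eq_iff, MulAction.Quotient.smul_mk, smul_eq_mul, mul_one,
        QuotientGroup.eq.mpr (show g⁻¹ * 1 ∈ S by simpa using hg)]
    simp [LinearEquiv.funCongrLeft_apply, LinearMap.funLeft_apply, Pi.single_apply, this]
  · have : ¬ (QuotientGroup.mk g⁻¹ : R ⧸ S) = QuotientGroup.mk 1 := by
      rw [QuotientGroup.eq]
      simpa using hg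
    simp [LinearEquiv.funCongrLeft_apply, LinearMap.funLeft_apply, this]

/-- Cyclic subgroups of `ℤ^n` are detected by isometries. -/
theorem nonempty_formRep_zpowers {n : ℕ} (x : Multiplicative (Fin n → ℤ)) (hx : x ≠ 1) :
    Nonempty (FormRep (Multiplicative (Fin n → ℤ)) (Subgroup.zpowers x)) := by
  obtain ⟨j, hj⟩ := Function.ne_iff.mp (show x.toAdd ≠ 0 from hx)
  replace hj : x.toAdd j ≠ 0 := hj
  -- The kernel of `φ` consists of the lattice points on the rational line through `x`; `ψ` then
  -- picks out the integral multiples of `x` by divisibility of the `j`-th coordinate.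
  let φ : Multiplicative (Fin n → ℤ) →* Multiplicative (Fin n → ℤ) :=
    AddMonoidHom.toMultiplicative
      { toFun := fun a i => x.toAdd j * a i - a j * x.toAdd i
        map_zero' := by ext; simp
        map_add' := fun a b => by ext; simp; ring }
  let ψ : Multiplicative (Fin n → ℤ) →* Multiplicative (ZMod (x.toAdd j).natAbs) :=
    AddMonoidHom.toMultiplicative
      ((Int.castAddHom (ZMod (x.toAdd j).natAbs)).comp (Pi.evalAddMonoidHom (fun _ => ℤ) j))
  have : NeZero (x.toAdd j).natAbs := ⟨Int.natAbs_ne_zero.mpr hj⟩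
  have : Finite (Multiplicative (Fin n → ℤ) ⧸ ψ.ker) :=
    Finite.of_equiv _ (QuotientGroup.quotientKerEquivRange ψ).toEquiv.symm
  obtain ⟨D⟩ := nonempty_formRep_ker φ
  obtain ⟨D'⟩ := nonempty_formRep_of_finite_quotient ψ.ker
  refine ⟨(D.inf D').copy ?_⟩
  ext a
  rw [Subgroup.mem_inf, MonoidHom.mem_ker, MonoidHom.mem_ker, Subgroup.mem_zpowers_iff]
  have hφ : φ a = 1 ↔ ∀ i, x.toAdd j * a.toAdd i - a.toAdd j * x.toAdd i = 0 := funext_iff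
  have hψ : ψ a = 1 ↔ x.toAdd j ∣ a.toAdd j := by
    rw [← Int.natAbs_dvd, ← ZMod.intCast_zmod_eq_zero_iff_dvd]
    exact Iff.rfl
  rw [hφ, hψ]
  constructor
  · rintro ⟨k, rfl⟩
    constructor
    · intro i
      simp
      ring
    · simp
  · rintro ⟨h1, t, ht⟩
    refine ⟨t, ?_⟩
    have : ∀ i, (x ^ t).toAdd i = a.toAdd i := fun i => by
      have h2 := h1 i
      rw [ht] at h2
      have h3 : x.toAdd j * (t * x.toAdd i - a.toAdd i) = 0 := by linarith
      have h4 := (mul_eq_zero.mp h3).resolve_left hj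
      simp only [toAdd_zpow, Pi.smul_apply, smul_eq_mul]
      linarith
    exact funext this

/-! ### Integral linearity -/

/-- A group is `ℤ`-linear if it acts faithfully on a lattice. -/
theorem isZLinear_of_lattice {G : Type*} [Group G] {M : Type*} [AddCommGroup M] [Module.Free ℤ M]
    [Module.Finite ℤ M] (ρ : G →* (M ≃ₗ[ℤ] M)) (hρ : Function.Injective ρ) : IsZLinear G := by
  let b := Module.finBasis ℤ M
  refine ⟨_, (Units.mapEquiv (LinearMap.toMatrixAlgEquiv b).toMulEquiv).toMonoidHom.comp
    ((LinearMap.GeneralLinearGroup.generalLinearEquiv ℤ M).symm.toMonoidHom.comp ρ), ?_⟩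
  exact (Units.mapEquiv (LinearMap.toMatrixAlgEquiv b).toMulEquiv).injective.comp
    ((LinearMap.GeneralLinearGroup.generalLinearEquiv ℤ M).symm.injective.comp hρ)

/-- A `ℤ`-linear group acts faithfully on a lattice. -/
theorem IsZLinear.exists_injective {G : Type*} [Group G] (h : IsZLinear G) :
    ∃ (n : ℕ) (ρ : G →* ((Fin n → ℤ) ≃ₗ[ℤ] (Fin n → ℤ))), Function.Injective ρ := by
  obtain ⟨n, ρ, hρ⟩ := h
  refine ⟨n, (LinearMap.GeneralLinearGroup.generalLinearEquiv ℤ _).toMonoidHom.comp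
    ((Units.mapEquiv (LinearMap.toMatrixAlgEquiv (Pi.basisFun ℤ (Fin n))).symm.toMulEquiv
      ).toMonoidHom.comp ρ), ?_⟩
  exact (LinearMap.GeneralLinearGroup.generalLinearEquiv ℤ _).injective.comp
    ((Units.mapEquiv _).injective.comp hρ)

/-- A group with a detected subgroup `S` is `ℤ`-linear if some homomorphism to a `ℤ`-linear group is
injective on `S`. -/
theorem FormRep.isZLinear {G H : Type*} [Group G] [Group H] {S : Subgroup G} (D : FormRep G S)
    (hH : IsZLinear H) (τ : G →* H) (hτ : ∀ g ∈ S, τ g = 1 → g = 1) : IsZLinear G := by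
  obtain ⟨n, ρ, hρ⟩ := hH.exists_injective
  -- The kernel of `D.rep` lies in `S`, and on `S` the second summand is faithful.
  refine isZLinear_of_lattice (FormRep.prodRep D.rep (ρ.comp τ)) ?_
  rw [injective_iff_map_eq_one]
  intro g hg
  have hx : ∀ x : D.carrier × (Fin n → ℤ), D.rep g x.1 = x.1 ∧ ρ (τ g) x.2 = x.2 := fun x => by
    simpa [Prod.ext_iff] using LinearEquiv.congr_fun hg x
  refine hτ g (D.mem_of_rep_eq_one (LinearEquiv.ext fun x => (hx (x, 0)).1)) (hρ ?_)
  rw [map_one]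
  exact LinearEquiv.ext fun x => (hx (0, x)).2

/-- The parabolic representation attached to the identity map detects the trivial subgroup, hence is
faithful. -/
theorem isZLinear_multiplicative_pi (n : ℕ) : IsZLinear (Multiplicative (Fin n → ℤ)) := by
  obtain ⟨D⟩ := nonempty_formRep_ker (MonoidHom.id (Multiplicative (Fin n → ℤ)))
  refine isZLinear_of_lattice D.rep ((injective_iff_map_eq_one _).mpr fun g hg => ?_)
  simpa using D.mem_of_rep_eq_one hg

/-! ### Extensions by commuting groups -/

/-- `G` is the amalgam of `R` with the products `⟨x i⟩ × L i` along the cyclic subgroups `⟨x i⟩`: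
the elements of `L i` commute with `x i`, the groups `R` and `L i` generate `G`, and compatible
homomorphisms extend to `G`. -/
structure IsCommutingExtension {R G I : Type*} [Group R] [Group G] {L : I → Type*}
    [∀ i, Group (L i)] (x : I → R) (ι : R →* G) (j : ∀ i, L i →* G) : Prop where
  comm : ∀ i l, Commute (ι (x i)) (j i l)
  generate : ∀ P : Subgroup G, (∀ r, ι r ∈ P) → (∀ i l, j i l ∈ P) → ∀ g, g ∈ P
  -- Targets in `Type` suffice: the property is applied only to automorphism groups of lattices and
  -- to `R` itself.
  lift : ∀ (H : Type) [Group H] (s : R →* H) (t : ∀ i, L i →* H),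
    (∀ i l, Commute (s (x i)) (t i l)) →
      ∃ ρ : G →* H, (∀ r, ρ (ι r) = s r) ∧ ∀ i l, ρ (j i l) = t i l

section Reduced

variable {R G I M : Type*} [Group R] [Group G] {L : I → Type*} [∀ i, Group (L i)]

/-- Products of conjugates of nontrivial elements of the groups `L i`, multiplied from the right by
an element of `R`, in which consecutive conjugates are marked by distinct labels. The option is the
label of the leftmost conjugate. -/
inductive IsReducedProduct (ι : R →* G) (j : ∀ i, L i →* G) (d : R → I → M) : Option M → G → Prop
  | base (r : R) : IsReducedProduct ι j d none (ι r)
  | step {o : Option M} {g : G} (r : R) (i : I) (l : L i) (hl : l ≠ 1) (hg : IsReducedProduct ι j d o g)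
      (ho : o ≠ some (d r i)) : IsReducedProduct ι j d (some (d r i)) (ι r * j i l * (ι r)⁻¹ * g)

variable {ι : R →* G} {j : ∀ i, L i →* G} {d : R → I → M}

/-- Left multiplication by `s` permutes the labels by the bijection `u s`, so neighbouring labels
stay distinct. -/
theorem IsReducedProduct.mul_left (u : R → M ≃ M) (hd : ∀ r s i, d (r * s) i = u r (d s i)) (s : R)
    {o : Option M} {g : G} (h : IsReducedProduct ι j d o g) :
    IsReducedProduct ι j d (o.map (u s)) (ι s * g) := by
  induction h with
  | base r =>
    rw [← map_mul]
    exact .base _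
  | @step o g r i l hl _ ho ih =>
    have h1 : ι s * (ι r * j i l * (ι r)⁻¹ * g) =
        ι (s * r) * j i l * (ι (s * r))⁻¹ * (ι s * g) := by
      rw [map_mul]
      group
    rw [h1, Option.map_some, ← hd]
    refine .step (s * r) i l hl ih fun h2 => ho ?_
    rw [hd] at h2
    obtain ⟨m, rfl, hm⟩ := Option.map_eq_some_iff.mp h2
    rw [(u s).injective hm]

/-- Every element of a commuting extension is a reduced product. -/
theorem IsCommutingExtension.exists_isReducedProduct {x : I → R} (hG : IsCommutingExtension x ι j)
    (u : R → M ≃ M) (hd : ∀ r s i, d (r * s) i = u r (d s i))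
    (hsep : ∀ r i k, d r i = d 1 k → i = k ∧ r ∈ Subgroup.zpowers (x i)) (g : G) :
    ∃ o, IsReducedProduct ι j d o g := by
  have hR : ∀ r g, (∃ o, IsReducedProduct ι j d o g) → ∃ o, IsReducedProduct ι j d o (ι r * g) :=
    fun r g ⟨_, h⟩ => ⟨_, h.mul_left u hd r⟩
  have hL : ∀ i l g, (∃ o, IsReducedProduct ι j d o g) → ∃ o, IsReducedProduct ι j d o (j i l * g) := by
    rintro i l g ⟨o, h⟩
    by_cases hl : l = 1
    · exact ⟨o, by simpa [hl] using h⟩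
    have key : ∀ {o g}, IsReducedProduct ι j d o g → o ≠ some (d 1 i) → ∀ l : L i, l ≠ 1 →
        IsReducedProduct ι j d (some (d 1 i)) (j i l * g) := fun hg ho l hl => by
      simpa using IsReducedProduct.step 1 i l hl hg ho
    by_cases ho : o = some (d 1 i)
    · cases h with
      | base r => cases ho
      | @step o' g' r k l' hl' hg' ho' =>
        have hd1 : d r k = d 1 i := Option.some.inj ho
        obtain ⟨rfl, hr⟩ := hsep r k i hd1
        -- Equal labels put `r` in `⟨x k⟩`, which commutes with `L k`, so the two neighbouring
        -- factors merge into one.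
        have hc : Commute (ι r) (j k l') := by
          obtain ⟨n, rfl⟩ := Subgroup.mem_zpowers_iff.mp hr
          rw [map_zpow]
          exact (hG.comm k l').zpow_left n
        have h1 : j k l * (ι r * j k l' * (ι r)⁻¹ * g') = j k (l * l') * g' := by
          rw [hc.eq, map_mul]
          group
        rw [h1]
        by_cases hll : l * l' = 1
        · exact ⟨o', by simpa [hll] using hg'⟩
        · exact ⟨_, key hg' (hd1 ▸ ho') _ hll⟩
    · exact ⟨_, key h ho l hl⟩
  -- The equivalence, rather than one implication, makes closure under inverses automatic.
  let P : Subgroup G :=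
    { carrier := {a | ∀ g, (∃ o, IsReducedProduct ι j d o g) ↔ ∃ o, IsReducedProduct ι j d o (a * g)}
      one_mem' := fun g => by simp
      mul_mem' := fun {a b} ha hb g => by rw [hb g, ha (b * g), mul_assoc]
      inv_mem' := fun {a} ha g => by rw [ha (a⁻¹ * g), mul_inv_cancel_left] }
  have hP := hG.generate P
    (fun r g => ⟨hR r g, fun h => by simpa [← mul_assoc, ← map_mul] using hR r⁻¹ _ h⟩)
    (fun i l g => ⟨hL i l g, fun h => by simpa [← mul_assoc, ← map_mul] using hL i l⁻¹ _ h⟩) g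
  have h1 := (hP 1).mp ⟨none, by simpa using IsReducedProduct.base (ι := ι) (j := j) (d := d) 1⟩
  rwa [mul_one] at h1

end Reduced

/-- Ping-pong for groups of Eichler transformations. -/
theorem IsCommutingExtension.form_lt {R G I M : Type*} [Group R] [Group G] {L : I → Type*}
    [∀ i, Group (L i)] {x : I → R} {ι : R →* G} {j : ∀ i, L i →* G}
    (hG : IsCommutingExtension x ι j) [AddCommGroup M] {J : Type*} [Fintype J]
    {B : LinearMap.BilinForm ℤ M} {f : J → M} {δ : I → M} (hE : ∀ i, IsEichlerPair B f (δ i))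
    (ρ : G →* (M ≃ₗ[ℤ] M)) (hB : ∀ r y z, B (ρ (ι r) y) (ρ (ι r) z) = B y z)
    (hf : ∀ r k, ρ (ι r) (f k) = f k)
    (hsep : ∀ r i k, B (ρ (ι r) (δ i)) (δ k) ≤ -12 ∨ (i = k ∧ r ∈ Subgroup.zpowers (x i)))
    (hfix : ∀ i, ρ (ι (x i)) (δ i) = δ i)
    (φ : ∀ i, L i →* Multiplicative (J → ℤ)) (hφ : ∀ i, Function.Injective (φ i))
    (hρ : ∀ i l, ρ (j i l) = (hE i).rep (φ i l))
    {e : M} (he : ∀ r, ρ (ι r) e = e) (hef : ∀ k, B e (f k) = 0) (heδ : ∀ i, B e (δ i) ≤ -12)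
    {g : G} (hg : g ∉ ι.range) : B (ρ g e) e < B e e := by
  -- The labels are the translates of the vectors `δ i` themselves; no uniqueness of normal forms is
  -- needed.
  let d : R → I → M := fun r i => ρ (ι r) (δ i)
  have hd : ∀ r s i, d (r * s) i = (ρ (ι r)).toEquiv (d s i) := fun r s i => by simp [d]
  have hd1 : ∀ i, d 1 i = δ i := fun i => by simp [d]
  have hEd : ∀ r i, IsEichlerPair B f (d r i) := fun r i =>
    { symm := (hE i).symm
      isotropic := by simp only [d, hB, (hE i).isotropic]
      orthogonal := fun k => by
        rw [← hf r k, hB, (hE i).orthogonal]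
      square := (hE i).square
      pairwise := (hE i).pairwise }
  have hstab : ∀ r i, r ∈ Subgroup.zpowers (x i) → d r i = δ i := by
    intro r i hr
    have h1 : Subgroup.zpowers (x i) ≤
        ((MulAction.stabilizer (M ≃ₗ[ℤ] M) (δ i)).comap (ρ.comp ι)) := by
      rw [Subgroup.zpowers_le]
      exact hfix i
    exact h1 hr
  have hdist : ∀ r i s k, d r i ≠ d s k → B (d r i) (d s k) ≤ -12 := by
    intro r i s k hne
    have h1 : B (d r i) (d s k) = B (ρ (ι (s⁻¹ * r)) (δ i)) (δ k) := by
      rw [← hB s (ρ (ι (s⁻¹ * r)) (δ i)), ← LinearEquiv.mul_apply, ← map_mul, ← map_mul,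
        mul_inv_cancel_left]
    rw [h1]
    refine (hsep (s⁻¹ * r) i k).resolve_right ?_
    rintro ⟨rfl, hr⟩
    refine hne ?_
    have h2 := hstab _ _ hr
    rw [show d r i = d (s * (s⁻¹ * r)) i by rw [mul_inv_cancel_left], hd, h2]
    simp [d]
  have hlab : ∀ r i k, d r i = d 1 k → i = k ∧ r ∈ Subgroup.zpowers (x i) := by
    intro r i k h
    refine (hsep r i k).resolve_left ?_
    rw [show ρ (ι r) (δ i) = δ k from h.trans (hd1 k), (hE k).isotropic]
    norm_num
  have hed : ∀ r i, B e (d r i) ≤ -12 := fun r i => by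
    rw [← he r, hB]
    exact heδ i
  -- Ping-pong invariant: `ρ g e` pairs negatively with every translate, dominates its pairings with
  -- the `f k` at every translate except the one used last, and has lost height against `e`.
  have main : ∀ o g, IsReducedProduct ι j d o g →
      (∀ r i, 0 < -B (ρ g e) (d r i)) ∧
      (∀ r i, o ≠ some (d r i) → ∀ k, 2 * |B (ρ g e) (f k)| ≤ -B (ρ g e) (d r i)) ∧
      B (ρ g e) e ≤ B e e ∧ (o ≠ none → B (ρ g e) e < B e e) := by
    intro o g h
    induction h with
    | base r =>
      rw [he]
      refine ⟨fun s i => by linarith [hed s i], fun s i _ k => ?_, le_rfl, fun h => (h rfl).elim⟩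
      rw [hef]
      linarith [hed s i, abs_zero (α := ℤ)]
    | @step o g r i l hl _ ho ih =>
      obtain ⟨ih1, ih2, ih3, -⟩ := ih
      have hv : ρ (ι r * j i l * (ι r)⁻¹ * g) e =
          eichlerMap B f (d r i) (φ i l).toAdd (ρ g e) := by
        have h1 := IsEichlerPair.apply_eichlerMap (δ := δ i) (ρ (ι r)) (hB r) (hf r) (φ i l).toAdd
          ((ρ (ι r))⁻¹ (ρ g e))
        rw [← (hE i).rep_apply, ← hρ] at h1
        rw [map_mul, map_mul, map_mul, map_inv, LinearEquiv.mul_apply, LinearEquiv.mul_apply,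
          LinearEquiv.mul_apply, h1, ← LinearEquiv.mul_apply (ρ (ι r)) (ρ (ι r))⁻¹, mul_inv_cancel]
        rfl
      have hl' : (φ i l).toAdd ≠ 0 := fun h0 => hl ((hφ i) (h0.trans (map_one (φ i)).symm))
      have grow := fun {y} => (hEd r i).growth (y := y) hl' (ih1 r i) (ih2 r i ho)
      rw [hv]
      have hfd : ∀ s k m, B (f m) (d s k) = 0 := fun s k m => by
        rw [(hE i).symm, (hEd s k).orthogonal]
      have hlt : B (eichlerMap B f (d r i) (φ i l).toAdd (ρ g e)) e < B (ρ g e) e :=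
        (grow (fun k => by rw [(hE i).symm, hef]) (by rw [(hE i).symm]; exact hed r i)).1
      refine ⟨fun s k => ?_, fun s k hne m => ?_, by linarith, fun _ => by linarith⟩
      · by_cases heq : d r i = d s k
        -- The transformation preserves the pairing with its own isotropic vector, so there is no
        -- growth there; hence the exception in the second clause.
        · rw [← heq, (hEd r i).form_eichlerMap_isotropic]
          exact ih1 r i
        · have := (grow (hfd s k) (hdist r i s k heq)).1
          linarith [ih1 s k]
      · have := (grow (hfd s k) (hdist r i s k fun h => hne (by rw [h]))).2 m
        linarith [ih1 s k]
  obtain ⟨o, ho⟩ := hG.exists_isReducedProduct (fun r => (ρ (ι r)).toEquiv) hd hlab g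
  refine (main o g ho).2.2.2 ?_
  rintro rfl
  cases ho with
  | base r => exact hg ⟨r, rfl⟩

/-! ### Detection of the base group of a commuting extension -/

/-- The bilinear form with prescribed diagonal entries and all other entries equal to `-12`. -/
noncomputable def gramForm {I : Type*} [Fintype I] [DecidableEq I] (c : I → ℤ) :
    LinearMap.BilinForm ℤ (I → ℤ) :=
  Matrix.toBilin' (Matrix.of fun i k => if i = k then c i else -12)

theorem gramForm_single {I : Type*} [Fintype I] [DecidableEq I] (c : I → ℤ) (i k : I) :
    gramForm c (Pi.single i 1) (Pi.single k 1) = if i = k then c i else -12 := by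
  simp [gramForm, Matrix.toBilin'_single]

theorem gramForm_symm {I : Type*} [Fintype I] [DecidableEq I] (c : I → ℤ) (y z : I → ℤ) :
    gramForm c y z = gramForm c z y := by
  simp only [gramForm, Matrix.toBilin'_apply, Matrix.of_apply]
  rw [Finset.sum_comm]
  refine Finset.sum_congr rfl fun i _ => Finset.sum_congr rfl fun k _ => ?_
  by_cases h : k = i
  · subst h
    ring
  · rw [if_neg h, if_neg (Ne.symm h)]
    ring

/-- The orthogonal sum of a family of forms, scaled by `12`. -/
noncomputable def piForm {I : Type*} [Fintype I] {M : I → Type*} [∀ i, AddCommGroup (M i)]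
    (B : ∀ i, LinearMap.BilinForm ℤ (M i)) : LinearMap.BilinForm ℤ (∀ i, M i) :=
  (12 : ℤ) • ∑ i, (B i).compl₁₂ (LinearMap.proj i) (LinearMap.proj i)

theorem piForm_apply {I : Type*} [Fintype I] {M : I → Type*} [∀ i, AddCommGroup (M i)]
    (B : ∀ i, LinearMap.BilinForm ℤ (M i)) (y z : ∀ i, M i) :
    piForm B y z = 12 * ∑ i, B i (y i) (z i) := by
  simp [piForm, LinearMap.sum_apply]

theorem piForm_single {I : Type*} [Fintype I] [DecidableEq I] {M : I → Type*}
    [∀ i, AddCommGroup (M i)] (B : ∀ i, LinearMap.BilinForm ℤ (M i)) (i : I) (y : M i)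
    (z : ∀ i, M i) : piForm B (Pi.single i y) z = 12 * B i y (z i) := by
  rw [piForm_apply, Finset.sum_eq_single i (fun k _ hk => by simp [Pi.single_eq_of_ne hk]) (by simp),
    Pi.single_eq_same]

/-- If the cyclic subgroups `⟨x i⟩` of `R` are detected by isometries, then so is `R` in a commuting
extension by groups that embed in a free abelian group of finite rank. -/
theorem IsCommutingExtension.nonempty_formRep_range {R I : Type} {G : Type*} [Group R] [Group G]
    [Finite I] {L : I → Type*} [∀ i, Group (L i)] {x : I → R} {ι : R →* G} {j : ∀ i, L i →* G}
    (hG : IsCommutingExtension x ι j)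
    (hx : ∀ i, Nonempty (FormRep R (Subgroup.zpowers (x i)))) {J : Type} [Fintype J]
    (φ : ∀ i, L i →* Multiplicative (J → ℤ)) (hφ : ∀ i, Function.Injective (φ i)) :
    Nonempty (FormRep G ι.range) := by
  classical
  have := Fintype.ofFinite I
  let D := fun i => (hx i).some
  -- The diagonal entry at `some i` makes `δ i` isotropic; the extra index `none` carries the vector
  -- `e`.
  let c : Option I → ℤ := fun o =>
    o.elim 0 fun i => -(12 * (D i).form (D i).vec (D i).vec)
  let N : LinearMap.BilinForm ℤ ((∀ i, (D i).carrier) × (Option I → ℤ)) :=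
    (piForm fun i => (D i).form).compl₁₂ (LinearMap.fst ℤ _ _) (LinearMap.fst ℤ _ _) +
      (gramForm c).compl₁₂ (LinearMap.snd ℤ _ _) (LinearMap.snd ℤ _ _)
  have hN : ∀ y z, N y z = piForm (fun i => (D i).form) y.1 z.1 + gramForm c y.2 z.2 :=
    fun y z => by simp [N]
  have hNs : ∀ y z, N y z = N z y := fun y z => by
    rw [hN, hN, gramForm_symm, piForm_apply, piForm_apply]
    simp only [(D _).symm (y.1 _)]
  let δ : I → (∀ i, (D i).carrier) × (Option I → ℤ) := fun i =>
    (Pi.single i (D i).vec, Pi.single (some i) 1)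
  have hE := fun i => isEichlerPair_sumStandardForm hNs J (δ := δ i) (by
    simp [δ, hN, piForm_single, gramForm_single, c])
  let π : R →* ((∀ i, (D i).carrier) ≃ₗ[ℤ] (∀ i, (D i).carrier)) :=
    { toFun := fun r => LinearEquiv.piCongrRight fun i => (D i).rep r
      map_one' := by ext; simp
      map_mul' := fun r s => by ext; simp }
  have hπ : ∀ r y i, π r y i = (D i).rep r (y i) := fun r y i => rfl
  have hπs : ∀ r i, π r (Pi.single i (D i).vec) = Pi.single i ((D i).rep r (D i).vec) := by
    intro r i
    ext k
    rw [hπ]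
    by_cases hk : k = i
    · subst hk
      simp
    · simp [hk]
  let σ := FormRep.prodRep (M := (∀ i, (D i).carrier) × (Option I → ℤ)) (N := J → ℤ)
    (FormRep.prodRep (N := Option I → ℤ) π 1) 1
  have hσ : ∀ r y, σ r y = ((π r y.1.1, y.1.2), y.2) := fun r y => rfl
  have hσB : ∀ r y z, sumStandardForm N J (σ r y) (σ r z) = sumStandardForm N J y z := by
    intro r y z
    simp [hσ, hN, piForm_apply, hπ, (D _).form_rep]
  have hσf : ∀ r k, σ r (0, Pi.single k 1) = (0, Pi.single k 1) := fun r k => by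
    rw [hσ]
    simp
  have hσx : ∀ i, σ (x i) (δ i, 0) = (δ i, 0) := fun i => by
    rw [hσ]
    simp only [δ, hπs, (D i).rep_vec (x i) (Subgroup.mem_zpowers _)]
  -- The required commutation holds because `σ (x i)` is an isometry fixing `δ i` and all the `f k`.
  obtain ⟨ρ, hρR, hρL⟩ := hG.lift _ σ (fun i => (hE i).rep.comp (φ i)) fun i l =>
    (hE i).commute_rep _ (hσB _) (hσf _) (hσx i) _
  let e : ((∀ i, (D i).carrier) × (Option I → ℤ)) × (J → ℤ) := ((0, Pi.single none 1), 0)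
  have he : ∀ r, σ r e = e := fun r => by
    rw [hσ]
    simp [e]
  refine ⟨{
    carrier := ((∀ i, (D i).carrier) × (Option I → ℤ)) × (J → ℤ)
    form := sumStandardForm N J
    symm := fun y z => by simp [hNs y.1 z.1, dotProduct_comm y.2 z.2]
    rep := ρ
    form_rep := ?_
    vec := e
    rep_vec := ?_
    form_lt := fun g hg => hG.form_lt hE ρ ?_ ?_ ?_ ?_ φ hφ hρL ?_ ?_ ?_ hg }⟩
  · let P : Subgroup G :=
      { carrier := {g | ∀ y z, sumStandardForm N J (ρ g y) (ρ g z) = sumStandardForm N J y z}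
        one_mem' := fun y z => by simp
        mul_mem' := fun {a b} ha hb y z => by
          rw [map_mul, LinearEquiv.mul_apply, LinearEquiv.mul_apply, ha, hb]
        inv_mem' := fun {a} ha y z => by
          rw [← ha, ← LinearEquiv.mul_apply, ← LinearEquiv.mul_apply, ← map_mul, mul_inv_cancel,
            map_one]
          rfl }
    refine hG.generate P (fun r y z => ?_) (fun i l y z => ?_)
    · rw [hρR, hσB]
    · rw [hρL]
      exact (hE i).form_rep _ _ _
  · rintro _ ⟨r, rfl⟩
    rw [hρR, he]
  · simpa only [hρR] using hσB
  · simpa only [hρR] using hσf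
  · intro r i k
    rw [hρR, hσ]
    simp only [δ, hπs, sumStandardForm_apply, hN, piForm_single, gramForm_single,
      Option.some_inj, zero_dotProduct]
    by_cases hik : i = k
    · subst hik
      by_cases hr : r ∈ Subgroup.zpowers (x i)
      · exact .inr ⟨rfl, hr⟩
      -- An integral strict drop is at least `1`, and the factor `12` in `piForm` turns it into
      -- `-12`.
      · have := (D i).form_lt r hr
        simp only [if_true, Pi.single_eq_same, c, Option.elim_some]
        exact .inl (by linarith)
    · simp [hik]
  · simpa only [hρR] using hσx
  · simpa only [hρR] using he
  · intro k
    simp [e]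
  · intro i
    simp [e, δ, hN, gramForm_single]

/-- A commuting extension of a `ℤ`-linear group `R` by groups that embed in a free abelian group of
finite rank is `ℤ`-linear if the cyclic subgroups `⟨x i⟩` are detected by isometries. -/
theorem IsCommutingExtension.isZLinear {R I : Type} {G : Type*} [Group R] [Group G]
    [Finite I] {L : I → Type*} [∀ i, Group (L i)] {x : I → R} {ι : R →* G} {j : ∀ i, L i →* G}
    (hG : IsCommutingExtension x ι j) (hR : IsZLinear R)
    (hx : ∀ i, Nonempty (FormRep R (Subgroup.zpowers (x i)))) {J : Type} [Fintype J]
    (φ : ∀ i, L i →* Multiplicative (J → ℤ)) (hφ : ∀ i, Function.Injective (φ i)) :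
    IsZLinear G := by
  obtain ⟨D⟩ := hG.nonempty_formRep_range hx φ hφ
  obtain ⟨τ, hτ, -⟩ := hG.lift R (MonoidHom.id R) (fun _ => 1) fun i l => Commute.one_right _
  refine D.isZLinear hR τ ?_
  rintro _ ⟨r, rfl⟩ hr
  rw [hτ] at hr
  rw [show r = 1 from hr, map_one]

/-! ### Coordinates on free abelian groups -/

/-- A basis vector of `ℤ^n`, in multiplicative notation. -/
def basisElt {n : ℕ} (i : Fin n) : Multiplicative (Fin n → ℤ) :=
  Multiplicative.ofAdd (Pi.single i 1)

/-- A coordinate of `ℤ^n`, in multiplicative notation. -/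
def coordHom {n : ℕ} (i : Fin n) : Multiplicative (Fin n → ℤ) →* Multiplicative ℤ :=
  AddMonoidHom.toMultiplicative (Pi.evalAddMonoidHom (fun _ => ℤ) i)

theorem coordHom_basisElt {n : ℕ} (i : Fin n) :
    coordHom i (basisElt i) = Multiplicative.ofAdd 1 :=
  congrArg Multiplicative.ofAdd (Pi.single_eq_same (M := fun _ => ℤ) i 1)

theorem basisElt_ne_one {n : ℕ} (i : Fin n) : basisElt i ≠ 1 := fun h => by
  have := coordHom_basisElt i
  rw [h, map_one] at this
  exact absurd this (by decide)

/-- The projection of `ℤ^n` to the kernel of a coordinate. -/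
def kerProj {n : ℕ} (i : Fin n) : Multiplicative (Fin n → ℤ) →* (coordHom i).ker :=
  MonoidHom.codRestrict
    (MonoidHom.id _ / (zpowersHom _ (basisElt i)).comp (coordHom i)) _ fun a => by
      simp [MonoidHom.mem_ker, coordHom_basisElt, ← ofAdd_zsmul]

theorem basisElt_zpow_mul_kerProj {n : ℕ} (i : Fin n) (a : Multiplicative (Fin n → ℤ)) :
    basisElt i ^ (coordHom i a).toAdd * (kerProj i a : Multiplicative (Fin n → ℤ)) = a := by
  simp [kerProj]

theorem kerProj_basisElt {n : ℕ} (i : Fin n) : kerProj i (basisElt i) = 1 := by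
  ext1
  simp [kerProj, coordHom_basisElt]

theorem kerProj_coe {n : ℕ} (i : Fin n) (l : (coordHom i).ker) : kerProj i l = l := by
  ext1
  simp [kerProj, MonoidHom.mem_ker.mp l.2]

/-- A homomorphism from `ℤ^n` is determined by commuting values on a basis vector and on the kernel
of the corresponding coordinate. -/
theorem exists_hom_of_coord {n : ℕ} (i : Fin n) {H : Type*} [Group H] (h : H)
    (t : (coordHom i).ker →* H) (hc : ∀ l, Commute h (t l)) :
    ∃ u : Multiplicative (Fin n → ℤ) →* H, u (basisElt i) = h ∧ ∀ l : (coordHom i).ker, u l = t l := by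
  refine ⟨(MonoidHom.noncommCoprod (zpowersHom H h) t fun m l => ?_).comp
    ((coordHom i).prod (kerProj i)), ?_, fun l => ?_⟩
  · rw [zpowersHom_apply]
    exact (hc l).zpow_left _
  · simp [kerProj_basisElt, coordHom_basisElt]
  · simp [kerProj_coe, MonoidHom.mem_ker.mp l.2]

theorem mem_of_coord {n : ℕ} (i : Fin n) {H : Type*} [Group H]
    (u : Multiplicative (Fin n → ℤ) →* H) (P : Subgroup H) (h : u (basisElt i) ∈ P)
    (hl : ∀ l : (coordHom i).ker, u l ∈ P) (a : Multiplicative (Fin n → ℤ)) : u a ∈ P := by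
  rw [← basisElt_zpow_mul_kerProj i a, map_mul, map_zpow]
  exact P.mul_mem (P.zpow_mem h _) (hl _)

theorem IsPrimitiveElt.exists_equiv {A : Type*} [Group A] {a : A} (h : IsPrimitiveElt a) :
    ∃ (n : ℕ) (i : Fin n) (f : A ≃* Multiplicative (Fin n → ℤ)), f a = basisElt i := by
  obtain ⟨n, b, ⟨f, hf⟩, i, rfl⟩ := h
  refine ⟨n, i, f.trans
    (AddEquiv.toMultiplicative (Finsupp.linearEquivFunOnFinite ℤ ℤ (Fin n)).toAddEquiv), ?_⟩
  rw [MulEquiv.trans_apply, hf]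
  exact congrArg Multiplicative.ofAdd (Finsupp.linearEquivFunOnFinite_single ℤ ℤ (Fin n) i 1)

/-! ### Amalgams of two free abelian groups along a primitive cyclic subgroup -/

section Amalgam

variable {n : Bool → ℕ} (i : ∀ b, Fin (n b))

/-- The homomorphisms from `ℤ` that send `1` to the chosen basis vectors. -/
def basisHom (b : Bool) : Multiplicative ℤ →* Multiplicative (Fin (n b) → ℤ) :=
  zpowersHom _ (basisElt (i b))

theorem basisHom_ofAdd_one (b : Bool) :
    basisHom i b (Multiplicative.ofAdd 1) = basisElt (i b) := by
  simp [basisHom]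

/-- The amalgam of two free abelian groups of finite rank in which the chosen basis vectors are
identified. -/
abbrev CyclicAmalgam : Type :=
  Monoid.PushoutI (basisHom i)

namespace CyclicAmalgam

/-- The inclusion of a factor. -/
def of (b : Bool) : Multiplicative (Fin (n b) → ℤ) →* CyclicAmalgam i :=
  Monoid.PushoutI.of (φ := basisHom i) b

theorem of_basisElt (b b' : Bool) : of i b (basisElt (i b)) = of i b' (basisElt (i b')) := by
  have h : ∀ b, of i b (basisElt (i b)) =
      Monoid.PushoutI.base (basisHom i) (Multiplicative.ofAdd 1) := fun b => by
    rw [← basisHom_ofAdd_one]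
    exact Monoid.PushoutI.of_apply_eq_base (basisHom i) b _
  rw [h, h]

variable {i}

theorem exists_lift {H : Type*} [Group H] (f : ∀ b, Multiplicative (Fin (n b) → ℤ) →* H)
    (hf : f false (basisElt (i false)) = f true (basisElt (i true))) :
    ∃ ρ : CyclicAmalgam i →* H, ∀ b a, ρ (of i b a) = f b a := by
  have h : ∀ b, (f b).comp (basisHom i b) = zpowersHom H (f true (basisElt (i true))) := by
    intro b
    ext
    cases b <;> simp [basisHom_ofAdd_one, hf]
  exact ⟨Monoid.PushoutI.lift f _ h, fun b a => Monoid.PushoutI.lift_of f _ h a⟩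

theorem exists_lift_pair {H : Type*} [Group H] (b : Bool)
    (s : Multiplicative (Fin (n b) → ℤ) →* H) (u : Multiplicative (Fin (n !b) → ℤ) →* H)
    (h : u (basisElt (i !b)) = s (basisElt (i b))) :
    ∃ ρ : CyclicAmalgam i →* H, (∀ a, ρ (of i b a) = s a) ∧ ∀ a, ρ (of i (!b) a) = u a := by
  cases b
  · obtain ⟨ρ, hρ⟩ := exists_lift (i := i) (fun | false => s | true => u) h.symm
    exact ⟨ρ, hρ false, hρ true⟩
  · obtain ⟨ρ, hρ⟩ := exists_lift (i := i) (fun | false => u | true => s) h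
    exact ⟨ρ, hρ true, hρ false⟩

theorem mem_of_forall_of_mem (P : Subgroup (CyclicAmalgam i)) (h : ∀ b a, of i b a ∈ P)
    (g : CyclicAmalgam i) : g ∈ P := by
  induction g using Monoid.PushoutI.induction_on with
  | of b a => exact h b a
  | base m =>
    rw [← Monoid.PushoutI.of_apply_eq_base (basisHom i) true]
    exact h true _
  | mul x y hx hy => exact P.mul_mem hx hy

/-- The amalgamated generator is a basis vector of the other factor, which therefore splits as its
span times the kernel of its coordinate. -/
theorem isCommutingExtension (b : Bool) :
    IsCommutingExtension (fun _ : Unit => basisElt (i b)) (of i b)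
      fun _ => (of i !b).comp (coordHom (i !b)).ker.subtype where
  comm _ l := by
    rw [of_basisElt i b (!b)]
    exact (Commute.all _ _).map (of i !b)
  generate P hR hL := by
    refine mem_of_forall_of_mem P fun b' a => ?_
    obtain rfl | rfl : b' = b ∨ b' = !b := by cases b <;> cases b' <;> simp
    · exact hR a
    · refine mem_of_coord (i !b) (of i !b) P ?_ (hL ()) a
      rw [of_basisElt i (!b) b]
      exact hR _
  lift H _ s t hst := by
    obtain ⟨u, hu, hut⟩ := exists_hom_of_coord (i !b) (s (basisElt (i b))) (t ()) (hst ())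
    obtain ⟨ρ, h1, h2⟩ := exists_lift_pair b s u hu
    exact ⟨ρ, h1, fun _ l => (h2 l).trans (hut l)⟩

theorem isZLinear : IsZLinear (CyclicAmalgam i) :=
  (isCommutingExtension true).isZLinear (isZLinear_multiplicative_pi _)
    (fun _ => nonempty_formRep_zpowers _ (basisElt_ne_one _)) (fun _ => Subgroup.subtype _)
    fun _ => Subtype.val_injective

/-- Cyclic subgroups of the factors are detected by isometries. -/
theorem nonempty_formRep_zpowers_of (b : Bool) (x : Multiplicative (Fin (n b) → ℤ)) (hx : x ≠ 1) :
    Nonempty (FormRep (CyclicAmalgam i) (Subgroup.zpowers (of i b x))) := by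
  obtain ⟨D⟩ := (isCommutingExtension (i := i) b).nonempty_formRep_range
    (fun _ => nonempty_formRep_zpowers _ (basisElt_ne_one _)) (fun _ => Subgroup.subtype _)
    fun _ => Subtype.val_injective
  obtain ⟨D'⟩ := nonempty_formRep_zpowers x hx
  -- This retraction onto the factor `b` collapses the other factor to its amalgamated coordinate.
  -- The subgroup sought consists of the elements of the factor that `π` sends into `⟨x⟩`.
  obtain ⟨π, hπ, -⟩ := exists_lift_pair (i := i) b (MonoidHom.id _)
    ((zpowersHom _ (basisElt (i b))).comp (coordHom (i !b))) (by simp [coordHom_basisElt])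
  refine ⟨(D.inf (D'.comap π)).copy ?_⟩
  rw [← MonoidHom.map_zpowers]
  ext g
  rw [Subgroup.mem_inf, Subgroup.mem_comap, Subgroup.mem_map]
  constructor
  · rintro ⟨a, ha, rfl⟩
    exact ⟨⟨a, rfl⟩, by simpa [hπ] using ha⟩
  · rintro ⟨⟨a, rfl⟩, ha⟩
    exact ⟨a, by simpa [hπ] using ha, rfl⟩

end CyclicAmalgam

end Amalgam

/-! ### Trees of diameter four -/

section Tree

variable {V : Type*} {T : SimpleGraph V}

/-- The first vertex of a longest path of a forest is a leaf. -/
theorem isExternalVertex_start_of_longest (hT : T.IsAcyclic) {x y : V} {p : T.Walk x y}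
    (hp : p.IsPath) (hlen : 0 < p.length)
    (hmax : ∀ (x' y' : V) (q : T.Walk x' y'), q.IsPath → q.length ≤ p.length) :
    IsExternalVertex T x := by
  have hnil : ¬ p.Nil := by
    rw [← SimpleGraph.Walk.length_eq_zero_iff]
    omega
  refine ⟨p.snd, p.adj_snd hnil, fun w hw => ?_⟩
  by_cases hmem : w ∈ p.support
  · exact hT.eq_snd_of_adj_start hp hw hmem
  · have h := hmax w y (.cons hw.symm p) (hp.cons hmem)
    rw [SimpleGraph.Walk.length_cons] at h
    omega

/-- Paths in a finite tree of diameter `4` have at most `3` edges. -/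
theorem HasTreeDiameter.length_le [Finite V] (hT : T.IsAcyclic) (h : HasTreeDiameter T 4) {x y : V}
    {p : T.Walk x y} (hp : p.IsPath) : p.length ≤ 3 := by
  classical
  have := Fintype.ofFinite V
  let S : Set ℕ := {m | ∃ (x y : V) (p : T.Walk x y), p.IsPath ∧ p.length = m}
  have hfin : S.Finite := (Set.finite_lt_nat (Fintype.card V)).subset fun m => by
    rintro ⟨x, y, p, hp, rfl⟩
    exact hp.length_lt
  -- A longest path among all paths, if not trivial, has leaves as its ends, so the diameter bounds
  -- it.
  obtain ⟨M, hM⟩ := hfin.exists_maximal ⟨p.length, x, y, p, hp, rfl⟩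
  have hle : ∀ m ∈ S, m ≤ M := fun m hm => (le_total m M).elim id fun h => hM.2 hm h
  obtain ⟨⟨u, v, q, hq, rfl⟩, -⟩ := hM
  have hmax : ∀ (x' y' : V) (r : T.Walk x' y'), r.IsPath → r.length ≤ q.length :=
    fun x' y' r hr => hle _ ⟨x', y', r, hr, rfl⟩
  refine (hmax _ _ p hp).trans ?_
  rcases Nat.eq_zero_or_pos q.length with h0 | hpos
  · omega
  have hu := isExternalVertex_start_of_longest hT hq hpos hmax
  have hv := isExternalVertex_start_of_longest hT (p := q.reverse) hq.reverse
    (by rwa [SimpleGraph.Walk.length_reverse])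
    (by simpa only [SimpleGraph.Walk.length_reverse] using hmax)
  have h4 := h.2 ⟨u, v, q, hu, hv, hq, rfl⟩
  rw [SimpleGraph.Walk.length_support] at h4
  omega

/-- In a finite tree of diameter `4`, each vertex that is not an endpoint of the bridge is a leaf
attached to an endpoint of the bridge. -/
theorem HasTreeDiameter.exists_doubleStar [Finite V] (hT : T.IsTree) (h : HasTreeDiameter T 4) :
    ∃ v : Bool → V, T.Adj (v false) (v true) ∧ (∀ b, ¬ IsExternalVertex T (v b)) ∧
      ∀ z, (∀ b, z ≠ v b) → ∃ b, T.Adj z (v b) ∧ ∀ w, T.Adj z w → w = v b := by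
  classical
  have hlen := fun {x y : V} {p : T.Walk x y} => h.length_le hT.isAcyclic (p := p)
  obtain ⟨⟨x, y, p, hx, hy, hp, hl⟩, -⟩ := h
  obtain ⟨a, b, hxa, hab, hby, hne⟩ : ∃ a b, T.Adj x a ∧ T.Adj a b ∧ T.Adj b y ∧
      [x, a, b, y].Nodup := by
    rw [SimpleGraph.Walk.length_support] at hl
    match p, hl, hp with
    | .cons h1 (.cons h2 (.cons h3 .nil)), _, hp =>
      exact ⟨_, _, h1, h2, h3, by simpa using hp.support_nodup⟩
  simp only [List.nodup_cons, List.mem_cons, List.not_mem_nil, or_false, not_or] at hne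
  obtain ⟨⟨hxa', hxb, hxy⟩, ⟨hab', hay⟩, hby', -⟩ := hne
  have hxu : ∀ w, T.Adj x w → w = a := fun w hw => hx.unique hw hxa
  have hyu : ∀ w, T.Adj y w → w = b := fun w hw => hy.unique hw hby.symm
  -- A path from `z` to `a` avoiding `b` also avoids the leaf `y`, so it extends through `b` to `y`.
  -- Two more edges are allowed only if it has length one.
  have far : ∀ a b y : V, T.Adj a b → T.Adj b y → a ≠ y → (∀ w, T.Adj y w → w = b) → ∀ z, z ≠ a →
      ∀ p : T.Walk z a, p.IsPath → b ∉ p.support → T.Adj z a := by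
    intro a b y hab hby hay hyu z hza p hp hb
    have hy : y ∉ p.support := by
      intro hy
      have hlast : ¬ (p.dropUntil y hy).Nil := by
        intro hn
        exact hay hn.eq.symm
      have h1 := hyu _ ((p.dropUntil y hy).adj_snd hlast)
      exact hb (p.support_dropUntil_subset_support hy (h1 ▸ (p.dropUntil y hy).getVert_mem_support 1))
    have h1 : (SimpleGraph.Walk.cons hby.symm (.cons hab.symm p.reverse)).IsPath := by
      refine (hp.reverse.cons (by simpa using hb)).cons ?_
      simp only [SimpleGraph.Walk.support_cons, SimpleGraph.Walk.support_reverse, List.mem_cons,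
        List.mem_reverse, not_or]
      exact ⟨hby.ne', hy⟩
    have h2 := hlen h1
    simp only [SimpleGraph.Walk.length_cons, SimpleGraph.Walk.length_reverse] at h2
    have h3 : p.length ≠ 0 := fun h0 => hza (SimpleGraph.Walk.eq_of_length_eq_zero h0)
    exact SimpleGraph.Walk.adj_of_length_eq_one (p := p) (by omega)
  -- A neighbour `w` of `z` other than `a` would give either a second path from `a` to `b` or the
  -- path `w, z, a, b, y`, which has four edges.
  have leaf : ∀ a b y : V, T.Adj a b → T.Adj b y → a ≠ y → (∀ w, T.Adj y w → w = b) → ∀ z, z ≠ b →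
      T.Adj z a → ∀ w, T.Adj z w → w = a := by
    intro a b y hab hby hay hyu z hzb hza w hzw
    by_contra hwa
    have hwb : w ≠ b := by
      rintro rfl
      have := hT.isAcyclic.subsingleton_path a w
      have h1 := Subsingleton.elim (α := T.Path a w)
        ⟨.cons hza.symm (.cons hzw .nil), by
          simp [SimpleGraph.Walk.cons_isPath_iff, hza.ne', hab.ne, hzb]⟩
        ⟨.cons hab .nil, by simp [SimpleGraph.Walk.cons_isPath_iff, hab.ne]⟩
      simpa using congrArg (fun p => p.1.length) h1
    have hzy : z ≠ y := by
      rintro rfl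
      exact hab.ne (hyu a hza)
    have hwy : w ≠ y := by
      rintro rfl
      exact hzb (hyu z hzw.symm)
    have h1 : (SimpleGraph.Walk.cons hzw.symm (.cons hza (.cons hab (.cons hby .nil)))).IsPath := by
      simp [SimpleGraph.Walk.cons_isPath_iff, hzw.ne', hwa, hwb, hwy, hza.ne, hzb, hzy, hab.ne, hay,
        hby.ne]
    simpa using hlen h1
  refine ⟨fun s => if s then b else a, by simpa using hab, ?_, ?_⟩
  · rintro (_ | _) hs
    · exact hxb (hs.unique (by simpa using hxa.symm) (by simpa using hab))
    · exact hay (hs.unique (by simpa using hab.symm) (by simpa using hby))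
  · intro z hz
    have hza : z ≠ a := by simpa using hz false
    have hzb : z ≠ b := by simpa using hz true
    obtain ⟨p, hp⟩ := hT.1.exists_isPath z a
    by_cases hb : b ∈ p.support
    · have hadj := far b a x hab.symm hxa.symm (Ne.symm hxb) hxu z hzb (p.takeUntil b hb)
        (hp.takeUntil hb) (by
          intro ha
          exact SimpleGraph.Walk.endpoint_notMem_support_takeUntil hp hb hab' ha)
      exact ⟨true, by simpa using hadj, by
        simpa using leaf b a x hab.symm hxa.symm (Ne.symm hxb) hxu z hza hadj⟩
    · have hadj := far a b y hab hby hay hyu z hza p hp hb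
      exact ⟨false, by simpa using hadj, by simpa using leaf a b y hab hby hay hyu z hzb hadj⟩

end Tree

/-! ### Fundamental groups of trees of groups -/

namespace GraphOfGroups

section FundamentalGroup

variable {V : Type u} {T : SimpleGraph V} (G : GraphOfGroups.{u, v, w} T)

/-- The map from a vertex group to the fundamental group of a tree of groups. -/
def vertexHom (x : V) : G.vertexGroup x →* G.FundamentalGroup T :=
  (QuotientGroup.mk' _).comp ((QuotientGroup.mk' _).comp (Monoid.Coprod.inl.comp Monoid.CoprodI.of))

theorem mk_stableLetter (d : T.Dart) :
    (QuotientGroup.mk' (Subgroup.normalClosure (G.treeLetters T)))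
      (QuotientGroup.mk' (Subgroup.normalClosure G.pathRelators) (G.stableLetter d)) = 1 :=
  (QuotientGroup.eq_one_iff _).mpr (Subgroup.subset_normalClosure ⟨d, d.adj, rfl⟩)

theorem vertexHom_dart (d : T.Dart) (g : G.edgeGroup (edgeOf d)) :
    G.vertexHom d.fst (G.initialMap d g) = G.vertexHom d.snd (G.terminalMap d g) := by
  have h : QuotientGroup.mk' (Subgroup.normalClosure G.pathRelators)
      (G.stableLetter d * G.vertexElt (G.initialMap d g) * (G.stableLetter d)⁻¹ *
        (G.vertexElt (G.terminalMap d g))⁻¹) = 1 :=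
    (QuotientGroup.eq_one_iff _).mpr (Subgroup.subset_normalClosure (.inl ⟨d, g, rfl⟩))
  have h2 := congrArg (QuotientGroup.mk' (Subgroup.normalClosure (G.treeLetters T))) h
  rw [map_mul, map_mul, map_mul, map_inv, map_inv, map_mul, map_mul, map_mul, map_inv, map_inv,
    G.mk_stableLetter, one_mul, inv_one, mul_one, map_one, mul_inv_eq_one] at h2
  exact h2

/-- The images of an edge group element in the groups of both endpoints agree. -/
theorem vertexHom_incl (e : T.edgeSet) (x y : V) (hx : x ∈ (e : Sym2 V)) (hy : y ∈ (e : Sym2 V))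
    (g : G.edgeGroup e) : G.vertexHom x (G.incl e x hx g) = G.vertexHom y (G.incl e y hy g) := by
  by_cases hxy : x = y
  · subst hxy
    rfl
  · obtain ⟨e, he⟩ := e
    obtain rfl : e = s(x, y) := (Sym2.mem_and_mem_iff hxy).mp ⟨hx, hy⟩
    exact G.vertexHom_dart ⟨(x, y), he⟩ g

theorem mem_of_forall_vertexHom_mem (P : Subgroup (G.FundamentalGroup T))
    (hP : ∀ x g, G.vertexHom x g ∈ P) (g : G.FundamentalGroup T) : g ∈ P := by
  obtain ⟨g, rfl⟩ := QuotientGroup.mk'_surjective _ g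
  obtain ⟨g, rfl⟩ := QuotientGroup.mk'_surjective _ g
  induction g using Monoid.Coprod.induction_on with
  | inl a =>
    induction a using Monoid.CoprodI.induction_on with
    | one => simp only [map_one, P.one_mem]
    | of x g => exact hP x g
    | mul a b ha hb => simpa only [map_mul] using P.mul_mem ha hb
  | inr a =>
    induction a using FreeGroup.induction_on with
    | C1 => simp only [map_one, P.one_mem]
    | of d =>
      exact (G.mk_stableLetter d).symm ▸ P.one_mem
    | inv_of d h => simpa only [map_inv] using P.inv_mem h
    | mul a b ha hb => simpa only [map_mul] using P.mul_mem ha hb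
  | mul a b ha hb => simpa only [map_mul] using P.mul_mem ha hb

/-- Homomorphisms on the vertex groups that are compatible along the edges extend to the fundamental
group of a tree of groups. -/
theorem exists_lift {H : Type*} [Group H] (f : ∀ x, G.vertexGroup x →* H)
    (hf : ∀ (e : T.edgeSet) (x y : V) (hx : x ∈ (e : Sym2 V)) (hy : y ∈ (e : Sym2 V))
      (g : G.edgeGroup e), f x (G.incl e x hx g) = f y (G.incl e y hy g)) :
    ∃ ρ : G.FundamentalGroup T →* H, ∀ x g, ρ (G.vertexHom x g) = f x g := by
  let F : G.BigFreeProduct →* H := Monoid.Coprod.lift (Monoid.CoprodI.lift f) 1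
  have hFv : ∀ x (g : G.vertexGroup x), F (G.vertexElt g) = f x g := fun x g => by
    simp [F, vertexElt]
  have hFt : ∀ d, F (G.stableLetter d) = 1 := fun d => by simp [F, stableLetter]
  have h1 : Subgroup.normalClosure G.pathRelators ≤ F.ker := by
    refine Subgroup.normalClosure_le_normal ?_
    rintro _ (⟨d, g, rfl⟩ | ⟨d, rfl⟩)
    · rw [SetLike.mem_coe, MonoidHom.mem_ker]
      simp only [map_mul, map_inv, hFv, hFt, one_mul, inv_one, mul_one]
      exact mul_inv_eq_one.mpr (hf _ _ _ _ _ g)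
    · rw [SetLike.mem_coe, MonoidHom.mem_ker, map_mul, hFt, hFt, one_mul]
  let F' : G.PathGroup →* H := QuotientGroup.lift _ F h1
  have h2 : Subgroup.normalClosure (G.treeLetters T) ≤ F'.ker := by
    refine Subgroup.normalClosure_le_normal ?_
    rintro _ ⟨d, -, rfl⟩
    exact hFt d
  exact ⟨QuotientGroup.lift _ F' h2, hFv⟩

end FundamentalGroup

end GraphOfGroups

/-! ### Decomposition of the fundamental group over the bridge -/

/-- The vertices of a finite tree of diameter `4`, listed as the endpoints of the bridge and the
leaves. -/
theorem HasTreeDiameter.exists_equiv {V : Type*} [Finite V] {T : SimpleGraph V} (hT : T.IsTree)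
    (h : HasTreeDiameter T 4) :
    ∃ (m : ℕ) (q : Bool ⊕ Fin m ≃ V) (side : Fin m → Bool),
      T.Adj (q (.inl false)) (q (.inl true)) ∧ (∀ b, ¬ IsExternalVertex T (q (.inl b))) ∧
      (∀ i, IsExternalVertex T (q (.inr i))) ∧
      (∀ i, T.Adj (q (.inr i)) (q (.inl (side i)))) ∧
      ∀ e ∈ T.edgeSet, e = s(q (.inl false), q (.inl true)) ∨
        ∃ i, e = s(q (.inr i), q (.inl (side i))) := by
  obtain ⟨v, hv, hint, hleaf⟩ := h.exists_doubleStar hT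
  have hinj : Function.Injective v := by
    rintro (_ | _) (_ | _) h
    exacts [rfl, absurd h hv.ne, absurd h hv.ne', rfl]
  obtain ⟨m, ⟨l⟩⟩ := Finite.exists_equiv_fin {z : V // ∀ b, z ≠ v b}
  choose p hp using fun i => hleaf (l.symm i).1 (l.symm i).2
  have hbij : Function.Bijective (Sum.elim v fun i => (l.symm i).1) := by
    constructor
    · refine hinj.sumElim (Subtype.val_injective.comp l.symm.injective) ?_
      exact fun b i h => (l.symm i).2 b h.symm
    · intro z
      by_cases hz : ∀ b, z ≠ v b
      · exact ⟨.inr (l ⟨z, hz⟩), by simp⟩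
      · push Not at hz
        obtain ⟨b, hb⟩ := hz
        exact ⟨.inl b, hb.symm⟩
  have hq : ∀ z, (∃ b, z = v b) ∨ ∃ i, z = (l.symm i).1 := fun z => by
    obtain ⟨b | i, rfl⟩ := hbij.2 z
    exacts [.inl ⟨b, rfl⟩, .inr ⟨i, rfl⟩]
  refine ⟨m, Equiv.ofBijective _ hbij, p, hv, hint, fun i => ⟨_, (hp i).1, (hp i).2⟩,
    fun i => (hp i).1, fun e he => ?_⟩
  induction e with
  | h x y =>
    rw [SimpleGraph.mem_edgeSet] at he
    obtain ⟨a, rfl⟩ | ⟨i, rfl⟩ := hq x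
    · obtain ⟨b, rfl⟩ | ⟨i, rfl⟩ := hq y
      · refine .inl ?_
        cases a <;> cases b
        exacts [absurd he (T.irrefl), rfl, Sym2.eq_swap, absurd he (T.irrefl)]
      · refine .inr ⟨i, ?_⟩
        rw [(hp i).2 _ he.symm]
        exact Sym2.eq_swap
    · refine .inr ⟨i, ?_⟩
      rw [(hp i).2 _ he]
      rfl

/-- The embedding of one summand in a finite sum of free abelian groups. -/
def sigmaSingle {m : ℕ} (n : Fin m → ℕ) (i : Fin m) :
    Multiplicative (Fin (n i) → ℤ) →* Multiplicative ((Σ i, Fin (n i)) → ℤ) :=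
  AddMonoidHom.toMultiplicative
    { toFun := fun y p => Pi.single (M := fun i => Fin (n i) → ℤ) i y p.1 p.2
      map_zero' := by ext; simp
      map_add' := fun y z => by ext; simp [Pi.single_add] }

theorem sigmaSingle_injective {m : ℕ} (n : Fin m → ℕ) (i : Fin m) :
    Function.Injective (sigmaSingle n i) := by
  intro y z h
  funext k
  have h1 := congrFun (show (sigmaSingle n i y).toAdd = (sigmaSingle n i z).toAdd from
    congrArg Multiplicative.toAdd h) ⟨i, k⟩
  have h2 : ∀ y : Multiplicative (Fin (n i) → ℤ), (sigmaSingle n i y).toAdd ⟨i, k⟩ = y.toAdd k :=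
    fun y => congrFun (Pi.single_eq_same (M := fun i => Fin (n i) → ℤ) i y.toAdd) k
  rw [h2, h2] at h1
  exact h1

theorem mainTheorem9 {V : Type u} [Finite V] (T : SimpleGraph V) (hT : T.IsTree)
    (hdiam : HasTreeDiameter T 4)
    (G : GraphOfGroups.{u, v, w} T)
    (hvertex : ∀ x : V, IsFreeAbelianOfFiniteRank (G.vertexGroup x))
    (k : ∀ e : T.edgeSet, G.edgeGroup e)
    (hcyclic : ∀ e : T.edgeSet, Subgroup.zpowers (k e) = ⊤)
    (hbridge : ∀ e : T.edgeSet, IsInternalEdge e →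
      ∀ (x : V) (hx : x ∈ (e : Sym2 V)), IsPrimitiveElt (G.incl e x hx (k e)))
    (hleaf : ∀ (e : T.edgeSet) (x : V) (hx : x ∈ (e : Sym2 V)), IsExternalVertex T x →
      IsPrimitiveElt (G.incl e x hx (k e))) :
    IsZLinear (G.FundamentalGroup T) := by
  obtain ⟨m, q, side, hbr, hint, hext, hadj, hedge⟩ := hdiam.exists_equiv hT
  let e₀ : T.edgeSet := ⟨s(q (.inl false), q (.inl true)), hbr⟩
  have h₀ : ∀ b, q (.inl b) ∈ (e₀ : Sym2 V) := by
    rintro (_ | _)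
    exacts [Sym2.mem_mk_left _ _, Sym2.mem_mk_right _ _]
  have h₀' : ∀ x ∈ (e₀ : Sym2 V), ∃ b, x = q (.inl b) := by
    intro x hx
    obtain rfl | rfl := Sym2.mem_iff.mp hx
    exacts [⟨_, rfl⟩, ⟨_, rfl⟩]
  let e : Fin m → T.edgeSet := fun i => ⟨s(q (.inr i), q (.inl (side i))), hadj i⟩
  have hz : ∀ i, q (.inr i) ∈ (e i : Sym2 V) := fun i => Sym2.mem_mk_left _ _
  have hs : ∀ i, q (.inl (side i)) ∈ (e i : Sym2 V) := fun i => Sym2.mem_mk_right _ _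
  choose n c F hF using fun b => (hbridge e₀ (fun x hx => by
    obtain ⟨b, rfl⟩ := h₀' x hx
    exact hint b) (q (.inl b)) (h₀ b)).exists_equiv
  choose n' c' F' hF' using fun i => (hleaf (e i) (q (.inr i)) (hz i) (hext i)).exists_equiv
  -- These elements may be proper powers; only `x i ≠ 1` is needed.
  let x : ∀ i, Multiplicative (Fin (n (side i)) → ℤ) :=
    fun i => F (side i) (G.incl (e i) _ (hs i) (k (e i)))
  have hx : ∀ i, x i ≠ 1 := by
    intro i h1
    have h2 : k (e i) = 1 :=
      G.incl_injective (e i) _ (hs i) ((F (side i)).injective (h1.trans (by simp)))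
    have h3 := hF' i
    rw [h2, map_one, map_one] at h3
    exact basisElt_ne_one _ h3.symm
  obtain ⟨ι, hι⟩ := CyclicAmalgam.exists_lift (i := c)
    (fun b => (G.vertexHom (q (.inl b))).comp (F b).symm.toMonoidHom) (by
      have h1 : ∀ b, (F b).symm (basisElt (c b)) = G.incl e₀ _ (h₀ b) (k e₀) := fun b => by
        rw [← hF, MulEquiv.symm_apply_apply]
      simpa [h1] using G.vertexHom_incl e₀ _ _ (h₀ false) (h₀ true) (k e₀))
  have hιF : ∀ b g, ι (CyclicAmalgam.of c b (F b g)) = G.vertexHom _ g := fun b g => by simp [hι]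
  let j' : ∀ i, Multiplicative (Fin (n' i) → ℤ) →* G.FundamentalGroup T :=
    fun i => (G.vertexHom (q (.inr i))).comp (F' i).symm.toMonoidHom
  have hj' : ∀ i g, j' i (F' i g) = G.vertexHom _ g := fun i g => by simp [j']
  have hxj : ∀ i, ι (CyclicAmalgam.of c (side i) (x i)) = j' i (basisElt (c' i)) := fun i => by
    rw [hιF, ← hF', hj']
    exact G.vertexHom_incl _ _ _ _ _ _
  have hcov : ∀ y, (∃ b, y = q (.inl b)) ∨ ∃ i, y = q (.inr i) := fun y => by
    obtain ⟨b | i, rfl⟩ := q.surjective y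
    exacts [.inl ⟨b, rfl⟩, .inr ⟨i, rfl⟩]
  have hG : IsCommutingExtension (fun i => CyclicAmalgam.of c (side i) (x i)) ι
      fun i => (j' i).comp (coordHom (c' i)).ker.subtype := by
    refine ⟨fun i l => ?_, fun P hR hL => ?_, fun H _ s t hst => ?_⟩
    · rw [hxj]
      exact (Commute.all _ _).map (j' i)
    · refine G.mem_of_forall_vertexHom_mem P fun y g => ?_
      obtain ⟨b, rfl⟩ | ⟨i, rfl⟩ := hcov y
      · rw [← hιF]
        exact hR _
      · rw [← hj']
        refine mem_of_coord (c' i) (j' i) P ?_ (hL i) _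
        rw [← hxj]
        exact hR _
    · choose u hu hut using fun i => exists_hom_of_coord (c' i) _ (t i) (hst i)
      let f : ∀ y, G.vertexGroup y →* H := q.piCongrLeft (fun y => G.vertexGroup y →* H)
        (Sum.rec (fun b => (s.comp (CyclicAmalgam.of c b)).comp (F b).toMonoidHom)
          fun i => (u i).comp (F' i).toMonoidHom)
      have hfb : ∀ b g, f (q (.inl b)) g = s (CyclicAmalgam.of c b (F b g)) := fun b g =>
        DFunLike.congr_fun (Equiv.piCongrLeft_apply_apply (fun y => G.vertexGroup y →* H) q _ _) g
      have hfi : ∀ i g, f (q (.inr i)) g = u i (F' i g) := fun i g =>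
        DFunLike.congr_fun (Equiv.piCongrLeft_apply_apply (fun y => G.vertexGroup y →* H) q _ _) g
      -- Since edge groups are cyclic, compatibility along an edge need only be checked on `k e`.
      have hval : ∀ e : T.edgeSet, ∃ a, ∀ y hy, f y (G.incl e y hy (k e)) = a := by
        rintro ⟨d, hd⟩
        obtain rfl | ⟨i, rfl⟩ := hedge d hd
        · refine ⟨s (CyclicAmalgam.of c true (basisElt (c true))), fun y hy => ?_⟩
          obtain ⟨b, rfl⟩ := h₀' y hy
          rw [hfb, CyclicAmalgam.of_basisElt c true b, ← hF b]
        · refine ⟨s (CyclicAmalgam.of c (side i) (x i)), fun y hy => ?_⟩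
          obtain rfl | rfl := Sym2.mem_iff.mp hy
          · rw [hfi, ← hu, ← hF']
          · rw [hfb]
      obtain ⟨ρ, hρ⟩ := G.exists_lift f fun d y z hy hz g => by
        obtain ⟨r, rfl⟩ := Subgroup.mem_zpowers_iff.mp (hcyclic d ▸ Subgroup.mem_top g)
        obtain ⟨a, ha⟩ := hval d
        simp only [map_zpow, ha]
      refine ⟨ρ, fun r => ?_, fun i l => ?_⟩
      · have := CyclicAmalgam.mem_of_forall_of_mem ((ρ.comp ι).eqLocus s) (fun b a => ?_) r
        · exact this
        · obtain ⟨g, rfl⟩ := (F b).surjective a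
          change ρ (ι _) = s _
          rw [hιF, hρ, hfb]
      · rw [← hut]
        obtain ⟨g, hg⟩ := (F' i).surjective (l : Multiplicative (Fin (n' i) → ℤ))
        rw [MonoidHom.comp_apply, Subgroup.subtype_apply, ← hg, hj', hρ, hfi]
  exact hG.isZLinear CyclicAmalgam.isZLinear
    (fun i => CyclicAmalgam.nonempty_formRep_zpowers_of _ _ (hx i))
    -- The direct sum of all leaf groups is one free abelian group receiving every `L i`.
    (fun i => (sigmaSingle n' i).comp (coordHom (c' i)).ker.subtype)
    fun i => (sigmaSingle_injective n' i).comp Subtype.val_injective
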